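/- Let $k$ be a field, $n\ge 0$, and let $d_0,\dots,d_n$ be positive integers with sum $w=\sum_{i=0}^n d_i$. Let $\mathcal X=[(\mathbb A^{n+1}_k\setminus 0)/\mathbb G_m]$ be the weighted projective stack with weights $d_0,\dots,d_n$, and let $S'=k[x_0,\dots,x_n,y_0,\dots,y_n]$ be the Cox ring of $\mathcal X\times\mathcal X$, $\mathbb Z^2$-graded by $\deg x_i=(d_i,0)$, $\deg y_i=(0,d_i)$. Write $\widetilde M$ for the quasi-coherent sheaf on $\mathcal X\times\mathcal X$ associated with a $\mathbb Z^2$-graded $S'$-module $M$, i.e. the $\mathbb G_m^2$-equivariant sheaf on $(\mathbb A^{n+1}\setminus 0)\times(\mathbb A^{n+1}\setminus 0)\subseteq \operatorname{Spec} S'$ defined by $M$. Let $F$ be the Koszul complex on the elements $y_0-x_0u^{d_0},\dots,y_n-x_nu^{d_n}$ of $S'[u]$, where $\deg u=(-1,1)$, regarded as a complex of graded $S'$-modules. With basis elements $e_I$, $I\subseteq\{0,\dots,n\}$, and $b_I=\sum_{l\in I}d_l$, its terms are $$F_i=\bigoplus_{a\ge 0}\ \bigoplus_{|I|=i} S'\cdot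 u^a e_I,\qquad S'\cdot u^ae_I\cong S'(a,-a-b_I).$$ Let $F'\subseteq F$ be spanned by the summands with $b_I<w-a$: $$F'_i=\bigoplus_{a\ge 0}\ \bigoplus_{|I|=i,\ b_I<w-a} S'\cdot u^ae_I .$$ Then $F'$ is a subcomplex of $F$ with homogeneous differential, each $F'_i$ is a free $S'$-module of finite rank with basis the $u^ae_I$ listed above, and $F'_i=0$ for $i>n$. Moreover the complex $\widetilde{F'}$ of sheaves on $\mathcal X\times\mathcal X$ is a resolution of $\mathcal O_\Delta:=\Delta_*\mathcal O_{\mathcal X}$, where $\Delta\colon\mathcal X\to\mathcal X\times\mathcal X$ is the diagonal. More precisely, the pullback of $\mathcal O_\Delta$ to $(\mathbb A^{n+1}\setminus 0)\times(\mathbb A^{n+1}\setminus 0)$ is the pushforward of the structure sheaf along $(\mathbb A^{n+1}\setminus 0)\times\mathbb G_m\to(\mathbb A^{n+1}\setminus 0)\times(\mathbb A^{n+1}\setminus 0)$, $(x,t)\mapsto(x,(t^{d_i}x_i)_i)$, and there is an equivariant morphism $\widetilde{F'_0}\to\mathcal O_\Delta$, sending the generator $u^a$ to the function $t^a$, that makes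 $\widetilde{F'}\to\mathcal O_\Delta$ a quasi-isomorphism. -/

import Mathlib

open CategoryTheory AlgebraicGeometry

/-!
Throughout, `k` is a field, `d 0, …, d n` are the weights, and

* `𝕏 = [(𝔸ⁿ⁺¹ ∖ 0) / 𝔾ₘ]` is the weighted projective stack `ℙ(d₀, …, dₙ)`;
* `S = k[x₀, …, xₙ]`, `deg xᵢ = dᵢ`, is its Cox ring, and
  `S' = k[x₀, …, xₙ, y₀, …, yₙ]` is the `ℤ × ℤ`-graded Cox ring of `𝕏 × 𝕏`.

A sheaf on `𝕏 × 𝕏 = [U / 𝔾ₘ²]`, `U = (𝔸ⁿ⁺¹ ∖ 0) × (𝔸ⁿ⁺¹ ∖ 0) ⊆ Spec S'`, is a `𝔾ₘ²`-equivariant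
sheaf on the smooth atlas `U → 𝕏 × 𝕏`; exactness is tested on the atlas, and for modules given
by graded modules the equivariant structure is the bigrading.
-/

noncomputable section

namespace WPS

/-! ### The Koszul differential -/

/-- The Koszul differential of `f₀, …, f_{m-1}`, on all exterior degrees at once.  A function
`g : Finset (Fin m) → R` stands for `∑_I g(I) e_I`, where `e_I = e_{i₁} ∧ ⋯ ∧ e_{iₚ}` for
`I = {i₁ < ⋯ < iₚ}`, and `e_I ↦ ∑_{j ∈ I} (-1)^{#{l ∈ I, l < j}} f_j e_{I ∖ j}`; the formula
below is the coefficient of `e_J` in the image of `g`. -/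
def koszulD {R : Type*} [CommRing R] {m : ℕ} (f : Fin m → R) :
    (Finset (Fin m) → R) →ₗ[R] (Finset (Fin m) → R) where
  toFun g J := ∑ j ∈ Jᶜ, (-1) ^ (J.filter (· < j)).card * f j * g (insert j J)
  map_add' g h := by
    funext J
    simp only [Pi.add_apply, mul_add, Finset.sum_add_distrib]
  map_smul' r g := by
    funext J
    simp only [Pi.smul_apply, smul_eq_mul, RingHom.id_apply, Finset.mul_sum]
    exact Finset.sum_congr rfl fun j _ => by ring

theorem koszulD_apply {R : Type*} [CommRing R] {m : ℕ} (f : Fin m → R)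
    (g : Finset (Fin m) → R) (J : Finset (Fin m)) :
    koszulD f g J = ∑ j ∈ Jᶜ, (-1) ^ (J.filter (· < j)).card * f j * g (insert j J) := rfl

theorem sign_swap {m : ℕ} (J : Finset (Fin m)) {j l : Fin m} (hj : j ∉ J) (_hl : l ∉ J)
    (h : j < l) (R : Type*) [CommRing R] :
    ((-1 : R) ^ (J.filter (· < j)).card * (-1) ^ ((insert j J).filter (· < l)).card) +
      (-1) ^ (J.filter (· < l)).card * (-1) ^ ((insert l J).filter (· < j)).card = 0 := by
  rw [Finset.filter_insert, Finset.filter_insert, if_pos h, if_neg (not_lt.mpr h.le),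
    Finset.card_insert_of_notMem (by simp [hj])]
  ring

theorem koszulD_koszulD {R : Type*} [CommRing R] {m : ℕ} (f : Fin m → R)
    (g : Finset (Fin m) → R) : koszulD f (koszulD f g) = 0 := by
  funext J
  simp only [koszulD_apply, Finset.mul_sum, Pi.zero_apply]
  rw [Finset.sum_sigma']
  refine Finset.sum_involution (fun p _ => ⟨p.2, p.1⟩) ?_ ?_ ?_ ?_
  · rintro ⟨j, l⟩ hp
    simp only [Finset.mem_sigma, Finset.mem_compl, Finset.mem_insert, not_or] at hp
    obtain ⟨hj, hlj, hl⟩ := hp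
    rw [Finset.insert_comm j l J]
    rcases lt_or_gt_of_ne hlj with h | h
    · linear_combination (f j * f l * g (insert l (insert j J))) * sign_swap J hl hj h R
    · linear_combination (f j * f l * g (insert l (insert j J))) * sign_swap J hj hl h R
  · rintro ⟨j, l⟩ hp _ heq
    simp only [Finset.mem_sigma, Finset.mem_compl, Finset.mem_insert, not_or] at hp
    exact hp.2.1 (congrArg Sigma.fst heq)
  · rintro ⟨j, l⟩ hp
    simp only [Finset.mem_sigma, Finset.mem_compl, Finset.mem_insert, not_or] at hp ⊢
    exact ⟨hp.2.2, fun h => hp.2.1 h.symm, hp.1⟩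
  · rintro ⟨j, l⟩ _
    rfl

/-! ### The complexes `F` and `F'` -/

/-- The Cox ring `S = k[x₀, …, xₙ]` of `𝕏`. -/
abbrev Cox (k : Type*) [Field k] (n : ℕ) : Type _ := MvPolynomial (Fin (n + 1)) k

/-- The Cox ring `S' = k[x₀, …, xₙ, y₀, …, yₙ]` of `𝕏 × 𝕏`. -/
abbrev Cox₂ (k : Type*) [Field k] (n : ℕ) : Type _ :=
  MvPolynomial (Fin (n + 1) ⊕ Fin (n + 1)) k

/-- The variable `xᵢ` of `S'`. -/
def xv (k : Type*) [Field k] {n : ℕ} (i : Fin (n + 1)) : Cox₂ k n := MvPolynomial.X (Sum.inl i)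

/-- The variable `yᵢ` of `S'`. -/
def yv (k : Type*) [Field k] {n : ℕ} (i : Fin (n + 1)) : Cox₂ k n := MvPolynomial.X (Sum.inr i)

/-- The ring `R = S'[Eff(𝕏)] = S'[ℤ_{≥ 0}]`, i.e. the polynomial ring `S'[u]`; the monomial
`u ^ a` corresponds to the effective degree `a ≥ 0` and has bidegree `(-a, a)`. -/
abbrev EffRing (k : Type*) [Field k] (n : ℕ) : Type _ := Polynomial (Cox₂ k n)

/-- The elements `yᵢ - xᵢ u^{dᵢ}` of `R`. -/
def koszulElt (k : Type*) [Field k] {n : ℕ} (d : Fin (n + 1) → ℕ) (i : Fin (n + 1)) :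
    EffRing k n :=
  Polynomial.C (yv k i) - Polynomial.C (xv k i) * Polynomial.X ^ d i

/-- The differential of the Koszul complex on `y₀ - x₀ u^{d₀}, …, yₙ - xₙ u^{dₙ}`, regarded as a
map of `S'`-modules. -/
def diff (k : Type*) [Field k] {n : ℕ} (d : Fin (n + 1) → ℕ) :
    (Finset (Fin (n + 1)) → EffRing k n) →ₗ[Cox₂ k n] (Finset (Fin (n + 1)) → EffRing k n) :=
  (koszulD (koszulElt k d)).restrictScalars (Cox₂ k n)

/-- The term `F_i = ⨁_{|I| = i} R e_I` of the Koszul complex, as an `S'`-module. -/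
def termF (k : Type*) [Field k] (n i : ℕ) :
    Submodule (Cox₂ k n) (Finset (Fin (n + 1)) → EffRing k n) where
  carrier := {g | ∀ I, I.card ≠ i → g I = 0}
  zero_mem' := fun _ _ => rfl
  add_mem' := fun {g h} hg hh I hI => by simp [hg I hI, hh I hI]
  smul_mem' := fun r g hg I hI => by simp [hg I hI]

/-- The `S'`-submodule `F'_i` of `F_i` spanned by the `u ^ a e_I`, `|I| = i`, with `b < w - a`;
here `b = ∑_{l ∈ I} d_l` is the degree of the dual of `e_I` in `ω_E`, and `w = ∑_l d_l`. -/
def termF' (k : Type*) [Field k] {n : ℕ} (d : Fin (n + 1) → ℕ) (i : ℕ) :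
    Submodule (Cox₂ k n) (Finset (Fin (n + 1)) → EffRing k n) where
  carrier := {g | ∀ I a, (g I).coeff a ≠ 0 → I.card = i ∧ a + ∑ l ∈ I, d l < ∑ l, d l}
  zero_mem' := fun I a h => by simp at h
  add_mem' := fun {g h} hg hh I a hne => by
    by_cases h0 : (g I).coeff a = 0
    · exact hh I a fun h1 => hne (by simp [h0, h1])
    · exact hg I a h0
  smul_mem' := fun r g hg I a hne => hg I a fun h0 => hne (by simp [h0])

theorem diff_mem_termF {k : Type*} [Field k] {n : ℕ} (d : Fin (n + 1) → ℕ) (i : ℕ)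
    (g : Finset (Fin (n + 1)) → EffRing k n) (hg : g ∈ termF k n (i + 1)) :
    diff k d g ∈ termF k n i := by
  intro J hJ
  change koszulD _ g J = 0
  rw [koszulD_apply]
  refine Finset.sum_eq_zero fun j hj => ?_
  rw [hg (insert j J) (by
    rw [Finset.card_insert_of_notMem (Finset.mem_compl.mp hj)]; omega), mul_zero]

theorem diff_mem_termF' {k : Type*} [Field k] {n : ℕ} (d : Fin (n + 1) → ℕ) (i : ℕ)
    (g : Finset (Fin (n + 1)) → EffRing k n) (hg : g ∈ termF' k d (i + 1)) :
    diff k d g ∈ termF' k d i := by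
  intro J a hne
  change (koszulD _ g J).coeff a ≠ 0 at hne
  rw [koszulD_apply, Polynomial.finsetSum_coeff] at hne
  obtain ⟨j, hj, hne⟩ := Finset.exists_ne_zero_of_sum_ne_zero hne
  have hjJ := Finset.mem_compl.mp hj
  have hcase : (g (insert j J)).coeff a ≠ 0 ∨
      (d j ≤ a ∧ (g (insert j J)).coeff (a - d j) ≠ 0) := by
    by_contra hcon
    push Not at hcon
    apply hne
    have hs : ((-1 : EffRing k n) ^ (J.filter (· < j)).card) =
        Polynomial.C ((-1 : Cox₂ k n) ^ (J.filter (· < j)).card) := by simp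
    rw [hs, mul_assoc, Polynomial.coeff_C_mul, koszulElt, sub_mul, Polynomial.coeff_sub,
      Polynomial.coeff_C_mul, hcon.1, mul_assoc, Polynomial.coeff_C_mul,
      Polynomial.coeff_X_pow_mul']
    split_ifs with h
    · rw [hcon.2 h]; simp
    · simp
  have hcard := Finset.card_insert_of_notMem hjJ
  have hsum := Finset.sum_insert (f := d) hjJ
  rcases hcase with h | ⟨hle, h⟩
  · have := hg _ _ h
    constructor <;> omega
  · have := hg _ _ h
    constructor <;> omega

theorem termF'_le_termF (k : Type*) [Field k] {n : ℕ} (d : Fin (n + 1) → ℕ) (i : ℕ) :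
    termF' k d i ≤ termF k n i := by
  intro g hg I hI
  ext1 a
  by_contra h
  exact hI (hg I a h).1

/-- The complex `F` of `S'`-modules: the Koszul complex on `yᵢ - xᵢ u^{dᵢ} ∈ R`, `0 ≤ i ≤ n`. -/
def F (k : Type*) [Field k] {n : ℕ} (d : Fin (n + 1) → ℕ) :
    ChainComplex (ModuleCat (CommRingCat.of (Cox₂ k n))) ℕ :=
  ChainComplex.of (fun i => ModuleCat.of (Cox₂ k n) (termF k n i))
    (fun i => ModuleCat.ofHom ((diff k d).restrict (diff_mem_termF d i)))
    (fun _ => by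
      ext1
      exact LinearMap.ext fun g => Subtype.ext (koszulD_koszulD _ _))

/-- The subcomplex `F'` of `F`. -/
def F' (k : Type*) [Field k] {n : ℕ} (d : Fin (n + 1) → ℕ) :
    ChainComplex (ModuleCat (CommRingCat.of (Cox₂ k n))) ℕ :=
  ChainComplex.of (fun i => ModuleCat.of (Cox₂ k n) (termF' k d i))
    (fun i => ModuleCat.ofHom ((diff k d).restrict (diff_mem_termF' d i)))
    (fun _ => by
      ext1
      exact LinearMap.ext fun g => Subtype.ext (koszulD_koszulD _ _))

theorem F_d (k : Type*) [Field k] {n : ℕ} (d : Fin (n + 1) → ℕ) (i : ℕ) :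
    (F k d).d (i + 1) i = ModuleCat.ofHom ((diff k d).restrict (diff_mem_termF d i)) :=
  ChainComplex.of_d (fun i => ModuleCat.of (Cox₂ k n) (termF k n i))
    (fun i => ModuleCat.ofHom ((diff k d).restrict (diff_mem_termF d i))) i

theorem F'_d (k : Type*) [Field k] {n : ℕ} (d : Fin (n + 1) → ℕ) (i : ℕ) :
    (F' k d).d (i + 1) i = ModuleCat.ofHom ((diff k d).restrict (diff_mem_termF' d i)) :=
  ChainComplex.of_d (fun i => ModuleCat.of (Cox₂ k n) (termF' k d i))
    (fun i => ModuleCat.ofHom ((diff k d).restrict (diff_mem_termF' d i))) i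

/-- The inclusion of complexes `F' ⟶ F`. -/
def inclF (k : Type*) [Field k] {n : ℕ} (d : Fin (n + 1) → ℕ) : F' k d ⟶ F k d :=
  ChainComplex.ofHom
    (fun i => ModuleCat.ofHom (Submodule.inclusion (termF'_le_termF k d i)))
    (fun i => by
      rw [F_d, F'_d]
      ext1
      exact LinearMap.ext fun g => Subtype.ext rfl)

/-- The indices `(a, I)` of the summands `(dual of e_I) ⊗ S'(a, -a-b)` of `F'_i`. -/
def Gen {n : ℕ} (d : Fin (n + 1) → ℕ) (i : ℕ) : Type :=
  {p : ℕ × Finset (Fin (n + 1)) // p.2.card = i ∧ p.1 + ∑ l ∈ p.2, d l < ∑ l, d l}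

/-- The bidegrees of the variables: `deg xᵢ = (dᵢ, 0)` and `deg yᵢ = (0, dᵢ)`. -/
def bideg {n : ℕ} (d : Fin (n + 1) → ℕ) : Fin (n + 1) ⊕ Fin (n + 1) → ℤ × ℤ :=
  Sum.elim (fun i => ((d i : ℤ), 0)) (fun i => (0, (d i : ℤ)))

/-- `g` is homogeneous of bidegree `χ`, where `u ^ a e_I` has bidegree `(-a, a + b)` with
`b = ∑_{l ∈ I} d_l`, i.e. where `u ^ a e_I` generates a copy of `S'(a, -a-b)`. -/
def IsHomog {k : Type*} [Field k] {n : ℕ} (d : Fin (n + 1) → ℕ) (χ : ℤ × ℤ)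
    (g : Finset (Fin (n + 1)) → EffRing k n) : Prop :=
  ∀ I a, MvPolynomial.IsWeightedHomogeneous (bideg d) ((g I).coeff a)
    (χ - (-(a : ℤ), (a : ℤ) + ∑ l ∈ I, (d l : ℤ)))

/-! ### The stack `𝕏 × 𝕏` and sheafification -/

/-- The atlas `U = (𝔸ⁿ⁺¹ ∖ 0) × (𝔸ⁿ⁺¹ ∖ 0)` of `𝕏 × 𝕏`: the complement in `Spec S'` of the
vanishing locus of the irrelevant ideal `(xᵢ yⱼ)_{i,j}`. -/
def atlas (k : Type*) [Field k] (n : ℕ) : (Spec (CommRingCat.of (Cox₂ k n))).Opens :=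
  ⨆ (i : Fin (n + 1)) (j : Fin (n + 1)), PrimeSpectrum.basicOpen (xv k i * yv k j)

/-- The functor that sends an `A`-module `M` to the restriction to an open subscheme `V` of
`Spec A` of the quasi-coherent sheaf associated with `M`. -/
def restrictedTilde (A : CommRingCat) (V : (Spec A).Opens) :
    ModuleCat A ⥤ V.toScheme.Modules :=
  tilde.functor A ⋙ Scheme.Modules.restrictFunctor V.ι

theorem restrictedTilde_zero (A : CommRingCat) (V : (Spec A).Opens) :
    (restrictedTilde A V).PreservesZeroMorphisms := by
  unfold restrictedTilde
  infer_instance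

/-- The sheaf on the atlas of `𝕏 × 𝕏` associated with an `S'`-module `M`: the restriction to
`U` of the quasi-coherent sheaf on `Spec S'` associated with `M`. -/
def sheafify (k : Type*) [Field k] (n : ℕ) :
    ModuleCat (CommRingCat.of (Cox₂ k n)) ⥤ (atlas k n).toScheme.Modules :=
  restrictedTilde (CommRingCat.of (Cox₂ k n)) (atlas k n)

instance (k : Type*) [Field k] (n : ℕ) : (sheafify k n).PreservesZeroMorphisms :=
  restrictedTilde_zero _ _

/-- The complex of sheaves associated with `F'`. -/
def sheafF' (k : Type*) [Field k] {n : ℕ} (d : Fin (n + 1) → ℕ) :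
    ChainComplex (atlas k n).toScheme.Modules ℕ :=
  ((sheafify k n).mapHomologicalComplex _).obj (F' k d)

/-- The global section of the sheaf associated with `M` that is given by an element of `M`. -/
def sectionOf {k : Type*} [Field k] {n : ℕ} (M : ModuleCat (CommRingCat.of (Cox₂ k n))) (m : M) :
    Γ((sheafify k n).obj M, ⊤) :=
  (tilde.toOpen M ((atlas k n).ι ''ᵁ ⊤)).hom m

/-! ### The diagonal -/

/-- The coordinate ring `S[t, t⁻¹]` of `𝔸ⁿ⁺¹ × 𝔾ₘ`. -/
abbrev DiagRing (k : Type*) [Field k] (n : ℕ) : Type _ := LaurentPolynomial (Cox k n)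

/-- The ring map `xᵢ ↦ xᵢ`, `yᵢ ↦ xᵢ t^{dᵢ}` of the shear morphism
`𝔸ⁿ⁺¹ × 𝔾ₘ → 𝔸ⁿ⁺¹ × 𝔸ⁿ⁺¹`, `(x, t) ↦ (x, t · x)`. -/
def shearRingHom (k : Type*) [Field k] {n : ℕ} (d : Fin (n + 1) → ℕ) :
    Cox₂ k n →+* DiagRing k n :=
  MvPolynomial.eval₂Hom (algebraMap k (DiagRing k n))
    (Sum.elim (fun i => LaurentPolynomial.C (MvPolynomial.X i))
      (fun i => LaurentPolynomial.C (MvPolynomial.X i) * LaurentPolynomial.T (d i)))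

/-- The shear morphism `𝔸ⁿ⁺¹ × 𝔾ₘ → 𝔸ⁿ⁺¹ × 𝔸ⁿ⁺¹`, `(x, t) ↦ (x, t · x)`. -/
def shear (k : Type*) [Field k] {n : ℕ} (d : Fin (n + 1) → ℕ) :
    Spec (CommRingCat.of (DiagRing k n)) ⟶ Spec (CommRingCat.of (Cox₂ k n)) :=
  Spec.map (CommRingCat.ofHom (shearRingHom k d))

/-- The open subscheme `W = (𝔸ⁿ⁺¹ ∖ 0) × 𝔾ₘ` of `𝔸ⁿ⁺¹ × 𝔾ₘ`, the preimage of the atlas.  It is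
the scheme of isomorphisms between the two points of `𝕏` parametrized by `U`, that is, the fibre
product of the atlas `U → 𝕏 × 𝕏` and the diagonal `Δ : 𝕏 → 𝕏 × 𝕏`, and its projection to `U` is
the shear morphism. -/
def isomOpen (k : Type*) [Field k] {n : ℕ} (d : Fin (n + 1) → ℕ) :
    (Spec (CommRingCat.of (DiagRing k n))).Opens :=
  shear k d ⁻¹ᵁ atlas k n

/-- The sheaf `𝒪_Δ = Δ_* 𝒪_𝕏` on the atlas `U` of `𝕏 × 𝕏`: by base change of `Δ` to `U`, it is
the pushforward of `𝒪_W` along the shear morphism `W → U`. -/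
def diagSheaf (k : Type*) [Field k] {n : ℕ} (d : Fin (n + 1) → ℕ) :
    (atlas k n).toScheme.Modules :=
  (Scheme.Modules.pushforward (shear k d ∣_ atlas k n)).obj
    (SheafOfModules.unit _ : (isomOpen k d).toScheme.Modules)

/-- The global section of `𝒪_Δ`, i.e. function on `W`, that is given by an element of
`S[t, t⁻¹]`. -/
def diagSection {k : Type*} [Field k] {n : ℕ} (d : Fin (n + 1) → ℕ) (s : DiagRing k n) :
    Γ(diagSheaf k d, ⊤) :=
  (isomOpen k d).ι.appTop.hom
    ((Scheme.ΓSpecIso (CommRingCat.of (DiagRing k n))).inv.hom s)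

/-- `s ∈ S[t, t⁻¹]` has weight `χ = (p, q)` for the action of `𝔾ₘ²` on `𝔸ⁿ⁺¹ × 𝔾ₘ` that makes the
shear morphism equivariant, `(l, m) · (x, t) = (l · x, l⁻¹ m t)`: that is, `s = f t ^ q` where
`f ∈ S` is homogeneous of degree `p + q`. -/
def HasWeight {k : Type*} [Field k] {n : ℕ} (d : Fin (n + 1) → ℕ) (χ : ℤ × ℤ)
    (s : DiagRing k n) : Prop :=
  ∃ f : Cox k n, MvPolynomial.IsWeightedHomogeneous (fun i => (d i : ℤ)) f (χ.1 + χ.2) ∧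
    s = LaurentPolynomial.C f * LaurentPolynomial.T χ.2

/-- The value in `S[t, t⁻¹]` at `g ∈ F'_0`, of the `S'`-linear augmentation with `u ^ a ↦ t ^ a`. -/
def augValue {k : Type*} [Field k] {n : ℕ} (d : Fin (n + 1) → ℕ)
    (g : Finset (Fin (n + 1)) → EffRing k n) : DiagRing k n :=
  (g ∅).eval₂ (shearRingHom k d) (LaurentPolynomial.T 1)

end WPS

end

/-! The Koszul complex `F` resolves `S[u]`. Substituting `y_i ↦ x_i u^{d_i}` for `i ∈ T` has kernel
exactly the ideal of the corresponding elements and fixes the others, so these elements form a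
regular sequence in any order, because `S'[u]` is a domain (`koszulElt_regular`,
`exists_koszulD_eq`).

To pass from `F` to `F'`, give `u^a e_I` the weight `a + b_I`. In the differential the `x_j u^{d_j}`
terms keep the weight and the `y_j` terms lower it, so `F'`, the part of weight below `w`, is a
subcomplex. In each weight `m ≥ w` every `I` occurs once, with exponent `m - b_I ≥ 0`, and the
graded piece is the whole Koszul complex on `-x_0, …, -x_n` (`weightPart_diff`). Exterior
multiplication by `e_l` makes `x_l` null-homotopic there. Removing the top weight repeatedly moves a
chain into `F'`, modulo boundaries, at the cost of a power of `x_l` (`exists_add_diff`), provided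
its boundary already has weight below `w`. Hence `F'` is exact in positive degrees, and at `F'_0`
over `S[t, t⁻¹]`, wherever some `x_l` is invertible.

The augmentation has image in `S[t]` and not all of `S[t, t⁻¹]`; powers of `y_j ↦ x_j t^{d_j}` clear
the negative powers of `t` (`exists_augValue_eq`). On the atlas some `x_i y_j` is invertible, and
since `M ↦ M~` is exact, these statements up to powers become exactness of sheaves
(`restrictedTilde_map_exact`). -/

noncomputable section

namespace WPS

/-! ### Koszul complexes of sequences that are regular in any order. -/

section Koszul

variable {R : Type*} [CommRing R] {m : ℕ}

/-- Exterior multiplication by `e_i`. -/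
def wedge (i : Fin m) : (Finset (Fin m) → R) →ₗ[R] (Finset (Fin m) → R) where
  toFun g J := if i ∈ J then (-1) ^ (J.filter (· < i)).card * g (J.erase i) else 0
  map_add' g h := by
    funext J
    by_cases hi : i ∈ J <;> simp [hi, mul_add]
  map_smul' r g := by
    funext J
    by_cases hi : i ∈ J <;> simp [hi, mul_left_comm]

theorem wedge_apply (i : Fin m) (g : Finset (Fin m) → R) (J : Finset (Fin m)) :
    wedge i g J = if i ∈ J then (-1) ^ (J.filter (· < i)).card * g (J.erase i) else 0 := rfl

theorem wedge_insert {i : Fin m} {K : Finset (Fin m)} (hi : i ∉ K) (g : Finset (Fin m) → R) :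
    wedge i g (insert i K) = (-1) ^ (K.filter (· < i)).card * g K := by
  rw [wedge_apply, if_pos (Finset.mem_insert_self _ _), Finset.erase_insert hi,
    Finset.filter_insert, if_neg (lt_irrefl i)]

theorem wedge_of_notMem {i : Fin m} {K : Finset (Fin m)} (hi : i ∉ K)
    (g : Finset (Fin m) → R) : wedge i g K = 0 := if_neg hi

theorem sign_mul_self (a : ℕ) : ((-1 : R) ^ a) * (-1) ^ a = 1 := by
  rw [← mul_pow]; simp

/-- Contraction is an antiderivation, so `e_i ∧` is a homotopy from multiplication by `f i` to zero.
It serves both the regular sequence of the `y_i - x_i u^{d_i}` and the sequence of the `x_i`. -/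
theorem koszulD_wedge (f : Fin m → R) (i : Fin m) (g : Finset (Fin m) → R) :
    koszulD f (wedge i g) + wedge i (koszulD f g) = f i • g := by
  funext J
  rw [Pi.add_apply, Pi.smul_apply, smul_eq_mul]
  by_cases hi : i ∈ J
  · obtain ⟨K, hK, rfl⟩ : ∃ K, i ∉ K ∧ insert i K = J :=
      ⟨J.erase i, Finset.notMem_erase _ _, Finset.insert_erase hi⟩
    rw [wedge_insert hK, koszulD_apply, koszulD_apply]
    have hc : Kᶜ = insert i (insert i K)ᶜ := by
      ext j
      simp only [Finset.mem_compl, Finset.mem_insert, not_or]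
      by_cases h : j = i
      · subst h; simp [hK]
      · simp [h]
    -- The term `j = i` gives `f i * g`; for each `j ≠ i` the contributions of the two composites
    -- cancel.
    rw [hc, Finset.sum_insert (by simp), mul_add, ← mul_assoc, ← mul_assoc, sign_mul_self,
      one_mul, add_left_comm, Finset.mul_sum, ← Finset.sum_add_distrib, Finset.sum_eq_zero,
      add_zero]
    intro j hj
    simp only [Finset.mem_compl, Finset.mem_insert, not_or] at hj
    obtain ⟨hji, hjK⟩ := hj
    rw [Finset.insert_comm, wedge_insert (by simp [hK, Ne.symm hji])]
    have hs : ((-1 : R) ^ (K.filter (· < j)).card * (-1) ^ ((insert j K).filter (· < i)).card) +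
        (-1) ^ (K.filter (· < i)).card * (-1) ^ ((insert i K).filter (· < j)).card = 0 := by
      rcases lt_or_gt_of_ne hji with h | h
      · exact sign_swap K hjK hK h R
      · rw [add_comm]; exact sign_swap K hK hjK h R
    have h1 := sign_mul_self (R := R) (K.filter (· < j)).card
    have h3 := sign_mul_self (R := R) ((insert i K).filter (· < j)).card
    -- Multiplying `hs` by two of its signs moves them to the other factors, since their squares are
    -- `1`.
    linear_combination (f j * g (insert j K)) *
      (hs * (-1) ^ (K.filter (· < j)).card * (-1) ^ ((insert i K).filter (· < j)).card -
        h3 * (-1) ^ (K.filter (· < j)).card * (-1) ^ (K.filter (· < i)).card -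
        h1 * (-1) ^ ((insert j K).filter (· < i)).card *
          (-1) ^ ((insert i K).filter (· < j)).card)
  · rw [wedge_of_notMem hi, add_zero, koszulD_apply,
      Finset.sum_eq_single_of_mem i (Finset.mem_compl.mpr hi), wedge_insert hi,
      mul_right_comm, ← mul_assoc, sign_mul_self, one_mul, mul_comm]
    intro j _ hji
    rw [wedge_of_notMem (by simp [hi, Ne.symm hji]), mul_zero]

/-- The elements of the Koszul complex that involve only the `e_I` with `I ⊆ T`. -/
def supportedOn (R : Type*) [CommRing R] {m : ℕ} (T : Finset (Fin m)) :
    Submodule R (Finset (Fin m) → R) where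
  carrier := {g | ∀ I, ¬ I ⊆ T → g I = 0}
  zero_mem' := fun _ _ => rfl
  add_mem' := fun {g h} hg hh I hI => by simp [hg I hI, hh I hI]
  smul_mem' := fun r g hg I hI => by simp [hg I hI]

theorem koszulD_mem_supportedOn (f : Fin m → R) {T : Finset (Fin m)} {g : Finset (Fin m) → R}
    (hg : g ∈ supportedOn R T) : koszulD f g ∈ supportedOn R T := by
  intro J hJ
  rw [koszulD_apply]
  refine Finset.sum_eq_zero fun j _ => ?_
  rw [hg _ fun h => hJ ((Finset.subset_insert j J).trans h), mul_zero]

theorem koszulD_empty_mem_span (f : Fin m → R) {T : Finset (Fin m)} {g : Finset (Fin m) → R}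
    (hg : g ∈ supportedOn R T) : koszulD f g ∅ ∈ Ideal.span (f '' T) := by
  rw [koszulD_apply]
  refine Ideal.sum_mem _ fun j _ => ?_
  by_cases hj : j ∈ T
  · exact Ideal.mul_mem_right _ _ (Ideal.mul_mem_left _ _
      (Ideal.subset_span (Set.mem_image_of_mem f hj)))
  · rw [hg _ fun h => hj (h (Finset.mem_insert_self _ _)), mul_zero]
    exact zero_mem _

theorem supportedOn_mono {S T : Finset (Fin m)} (h : S ⊆ T) : supportedOn R S ≤ supportedOn R T :=
  fun _ hg I hI => hg I fun h' => hI (h'.trans h)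

theorem wedge_mem_supportedOn {t : Fin m} {T : Finset (Fin m)} {g : Finset (Fin m) → R}
    (hg : g ∈ supportedOn R T) : wedge t g ∈ supportedOn R (insert t T) := by
  intro J hJ
  rw [wedge_apply]
  split_ifs with ht
  · rw [hg _ fun h => hJ ?_, mul_zero]
    rw [← Finset.insert_erase ht]
    exact Finset.insert_subset_insert t h
  · rfl

/-- On elements that do not involve `e_t`, the map `e_t ∧` only relabels coordinates up to sign. -/
theorem eq_zero_of_wedge {t : Fin m} {T : Finset (Fin m)} (ht : t ∉ T)
    {g : Finset (Fin m) → R} (hg : g ∈ supportedOn R T)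
    (h : ∀ K, t ∉ K → wedge t g (insert t K) = 0) : g = 0 := by
  funext K
  by_cases hK : t ∈ K
  · exact hg K fun h' => ht (h' hK)
  · have := h K hK
    rw [wedge_insert hK] at this
    rw [Pi.zero_apply, ← one_mul (g K), ← sign_mul_self (K.filter (· < t)).card, mul_assoc, this,
      mul_zero]

/-- Elements supported on `insert t T` split as `g₀ + e_t ∧ g₁`. -/
theorem exists_add_wedge {t : Fin m} {T : Finset (Fin m)}
    {g : Finset (Fin m) → R} (hg : g ∈ supportedOn R (insert t T)) :
    ∃ g₀ ∈ supportedOn R T, ∃ g₁ ∈ supportedOn R T, g = g₀ + wedge t g₁ := by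
  let g₁ : Finset (Fin m) → R := fun J =>
    if t ∈ J then 0 else (-1) ^ (J.filter (· < t)).card * g (insert t J)
  refine ⟨g - wedge t g₁, fun J hJ => ?_, g₁, fun J hJ => ?_, (sub_add_cancel _ _).symm⟩
  · by_cases htJ : t ∈ J
    · obtain ⟨K, hK, rfl⟩ : ∃ K, t ∉ K ∧ insert t K = J :=
        ⟨J.erase t, Finset.notMem_erase _ _, Finset.insert_erase htJ⟩
      rw [Pi.sub_apply, wedge_insert hK]
      simp only [g₁, if_neg hK]
      rw [← mul_assoc, sign_mul_self, one_mul, sub_self]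
    · rw [Pi.sub_apply, wedge_of_notMem htJ, sub_zero]
      exact hg J fun h => hJ fun a ha => (Finset.mem_insert.mp (h ha)).resolve_left
        fun e => htJ (e ▸ ha)
  · simp only [g₁]
    split_ifs with htJ
    · rfl
    · rw [hg _ fun h => hJ fun a ha => (Finset.mem_insert.mp
        (h (Finset.mem_insert_of_mem ha))).resolve_left fun e => htJ (e ▸ ha), mul_zero]

/-- Exactness of the Koszul complex of a sequence that is regular in any order. -/
theorem exists_koszulD_eq {f : Fin m → R}
    (hreg : ∀ (T : Finset (Fin m)) (t : Fin m), t ∉ T → ∀ r, f t * r ∈ Ideal.span (f '' T) →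
      r ∈ Ideal.span (f '' T)) (T : Finset (Fin m)) :
    ∀ g ∈ supportedOn R T, koszulD f g = 0 → g ∅ ∈ Ideal.span (f '' T) →
      ∃ h ∈ supportedOn R T, koszulD f h = g := by
  induction T using Finset.induction_on with
  | empty =>
    intro g hg _ h0
    refine ⟨0, zero_mem _, ?_⟩
    rw [map_zero]
    funext J
    by_cases hJ : J ⊆ ∅
    · rw [Finset.subset_empty.mp hJ]
      rw [Finset.coe_empty, Set.image_empty, Ideal.span_empty, Ideal.mem_bot] at h0
      exact h0.symm
    · exact (hg J hJ).symm
  | insert t T ht ih =>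
    intro g hg hDg h0
    obtain ⟨g₀, hg₀, g₁, hg₁, rfl⟩ := exists_add_wedge hg
    have hw := koszulD_wedge f t g₁
    have hD : koszulD f g₀ + f t • g₁ = wedge t (koszulD f g₁) := by
      rw [map_add] at hDg
      linear_combination (exp := 1) hDg - hw
    -- The left side of `hD` involves no `e_t` and the right side only sets containing `t`, so both
    -- vanish.
    have hD₁ : koszulD f g₁ = 0 := by
      refine eq_zero_of_wedge ht (koszulD_mem_supportedOn f hg₁) fun K hK => ?_
      rw [← hD]
      exact (add_mem (koszulD_mem_supportedOn f hg₀) ((supportedOn R T).smul_mem (f t) hg₁)) _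
        fun h => ht (h (Finset.mem_insert_self _ _))
    rw [hD₁, map_zero] at hD
    -- The `∅` coordinate of `hD` says that `f t * g₁ ∅` is a boundary value of `g₀`; regularity of
    -- `f t` cancels the factor.
    have h₁ : g₁ ∅ ∈ Ideal.span (f '' T) := by
      refine hreg T t ht _ ?_
      have := congr_fun hD ∅
      simp only [Pi.add_apply, Pi.smul_apply, smul_eq_mul, Pi.zero_apply] at this
      rw [← neg_eq_of_add_eq_zero_right this]
      exact neg_mem (koszulD_empty_mem_span f hg₀)
    obtain ⟨h₁, hh₁, e₁⟩ := ih g₁ hg₁ hD₁ h₁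
    have hw₁ := koszulD_wedge f t h₁
    rw [e₁] at hw₁
    rw [Pi.add_apply, wedge_of_notMem (Finset.notMem_empty t), add_zero, Finset.coe_insert,
      Set.image_insert_eq, Ideal.mem_span_insert] at h0
    obtain ⟨b, z, hz, e₀⟩ := h0
    -- The cycle `g₀ + f t • h₁` has `∅` coordinate `(b + h₁ ∅) * f t + z`. Subtracting `f t • c`,
    -- which bounds `e_t ∧ c`, leaves `z` in the ideal of `T`, as induction requires.
    let c : Finset (Fin m) → R := Pi.single ∅ (b + h₁ ∅)
    have hc : c ∈ supportedOn R T := fun I hI => Pi.single_eq_of_ne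
      (fun h => hI (by rw [h]; exact Finset.empty_subset T)) _
    have hDc : koszulD f c = 0 := by
      funext J
      rw [koszulD_apply]
      refine Finset.sum_eq_zero fun j _ => ?_
      simp only [c]
      rw [Pi.single_eq_of_ne (Finset.insert_ne_empty _ _), mul_zero]
    have hwc := koszulD_wedge f t c
    rw [hDc, map_zero, add_zero] at hwc
    have hD₀ : koszulD f (g₀ + f t • h₁ - f t • c) = 0 := by
      rw [map_sub, map_add, map_smul, map_smul, hDc, e₁, smul_zero, sub_zero, hD]
    obtain ⟨h₂, hh₂, e₂⟩ := ih (g₀ + f t • h₁ - f t • c)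
      (sub_mem (add_mem hg₀ ((supportedOn R T).smul_mem _ hh₁))
        ((supportedOn R T).smul_mem _ hc)) hD₀ (by
        simp only [Pi.sub_apply, Pi.add_apply, Pi.smul_apply, smul_eq_mul, c, Pi.single_eq_same, e₀]
        convert hz using 1
        ring)
    refine ⟨h₂ - wedge t h₁ + wedge t c, add_mem (sub_mem
      (supportedOn_mono (Finset.subset_insert t T) hh₂) (wedge_mem_supportedOn hh₁))
      (wedge_mem_supportedOn hc), ?_⟩
    rw [map_add, map_sub, e₂, hwc]
    linear_combination (exp := 1) -hw₁

end Koszul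

/-! ### Exactness of `F` and the kernel of the augmentation. -/

section Exactness

variable {k : Type*} [Field k] {n : ℕ}

/-- The substitution `y_i ↦ x_i u ^ {d_i}` for `i ∈ T`. -/
def substHom (k : Type*) [Field k] {n : ℕ} (d : Fin (n + 1) → ℕ) (T : Finset (Fin (n + 1))) :
    EffRing k n →+* EffRing k n :=
  Polynomial.eval₂RingHom (MvPolynomial.eval₂Hom (Polynomial.C.comp MvPolynomial.C)
    (Sum.elim (fun i => Polynomial.C (xv k i))
      (fun i => if i ∈ T then Polynomial.C (xv k i) * Polynomial.X ^ d i
        else Polynomial.C (yv k i)))) Polynomial.X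

@[simp] theorem substHom_X (d : Fin (n + 1) → ℕ) (T : Finset (Fin (n + 1))) :
    substHom k d T Polynomial.X = Polynomial.X := by simp [substHom]

@[simp] theorem substHom_C_C (d : Fin (n + 1) → ℕ) (T : Finset (Fin (n + 1))) (a : k) :
    substHom k d T (Polynomial.C (MvPolynomial.C a)) = Polynomial.C (MvPolynomial.C a) := by
  simp [substHom]

@[simp] theorem substHom_xv (d : Fin (n + 1) → ℕ) (T : Finset (Fin (n + 1))) (i : Fin (n + 1)) :
    substHom k d T (Polynomial.C (xv k i)) = Polynomial.C (xv k i) := by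
  simp [substHom, xv]

theorem substHom_yv (d : Fin (n + 1) → ℕ) (T : Finset (Fin (n + 1))) (i : Fin (n + 1)) :
    substHom k d T (Polynomial.C (yv k i)) =
      if i ∈ T then Polynomial.C (xv k i) * Polynomial.X ^ d i else Polynomial.C (yv k i) := by
  simp [substHom, yv]

theorem substHom_koszulElt (d : Fin (n + 1) → ℕ) (T : Finset (Fin (n + 1))) (i : Fin (n + 1)) :
    substHom k d T (koszulElt k d i) = if i ∈ T then 0 else koszulElt k d i := by
  rw [koszulElt, map_sub, substHom_yv, map_mul, map_pow, substHom_X, substHom_xv]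
  split_ifs <;> simp

theorem effRing_ringHom_ext {A : Type*} [CommSemiring A] {φ ψ : EffRing k n →+* A}
    (hC : ∀ a, φ (Polynomial.C (MvPolynomial.C a)) = ψ (Polynomial.C (MvPolynomial.C a)))
    (hx : ∀ i, φ (Polynomial.C (xv k i)) = ψ (Polynomial.C (xv k i)))
    (hy : ∀ i, φ (Polynomial.C (yv k i)) = ψ (Polynomial.C (yv k i)))
    (hX : φ Polynomial.X = ψ Polynomial.X) : φ = ψ := by
  refine Polynomial.ringHom_ext' (MvPolynomial.ringHom_ext hC ?_) hX
  rintro (i | i)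
  · exact hx i
  · exact hy i

/-- Modulo the ideal the substitution is the identity, and it kills every generator of the ideal. -/
theorem substHom_eq_zero_iff (d : Fin (n + 1) → ℕ) (T : Finset (Fin (n + 1))) (p : EffRing k n) :
    substHom k d T p = 0 ↔ p ∈ Ideal.span (koszulElt k d '' T) := by
  constructor
  · intro h
    have e : (Ideal.Quotient.mk (Ideal.span (koszulElt k d '' T))).comp (substHom k d T) =
        Ideal.Quotient.mk (Ideal.span (koszulElt k d '' T)) := by
      refine effRing_ringHom_ext (A := EffRing k n ⧸ Ideal.span (koszulElt k d '' T))
        (fun a => ?_) (fun i => ?_) (fun i => ?_) ?_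
      · rw [RingHom.comp_apply, substHom_C_C]
      · rw [RingHom.comp_apply, substHom_xv]
      swap
      · rw [RingHom.comp_apply, substHom_X]
      rw [RingHom.comp_apply, substHom_yv]
      split_ifs with hi
      · refine (Ideal.Quotient.eq.mpr ?_).symm
        exact Ideal.subset_span (Set.mem_image_of_mem _ hi)
      · rfl
    have := congr($e p)
    rw [RingHom.comp_apply, h, map_zero] at this
    exact Ideal.Quotient.eq_zero_iff_mem.mp this.symm
  · intro h
    refine (Ideal.span_le.mpr ?_ : _ ≤ RingHom.ker (substHom k d T)) h
    rintro _ ⟨i, hi, rfl⟩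
    change substHom k d T _ = 0
    rw [substHom_koszulElt, if_pos (Finset.mem_coe.mp hi)]

theorem koszulElt_ne_zero (d : Fin (n + 1) → ℕ) (hd : ∀ i, 0 < d i) (i : Fin (n + 1)) :
    koszulElt k d i ≠ 0 := by
  intro h
  have := congr_arg (Polynomial.coeff · 0) h
  simp [koszulElt, yv, Polynomial.coeff_X_pow, (hd i).ne] at this

/-- The substitution embeds the quotient in the domain `S'[u]` and sends the element with index `t ∉
T` to itself, which is nonzero. -/
theorem koszulElt_regular (d : Fin (n + 1) → ℕ) (hd : ∀ i, 0 < d i) (T : Finset (Fin (n + 1)))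
    (t : Fin (n + 1)) (ht : t ∉ T) (r : EffRing k n)
    (h : koszulElt k d t * r ∈ Ideal.span (koszulElt k d '' T)) :
    r ∈ Ideal.span (koszulElt k d '' T) := by
  rw [← substHom_eq_zero_iff, map_mul, substHom_koszulElt, if_neg ht] at h
  exact (substHom_eq_zero_iff d T r).mp
    ((mul_eq_zero.mp h).resolve_left (koszulElt_ne_zero d hd t))

/-- The projection to the summands `e_I` with `|I| = c`. -/
def cardPart {R : Type*} [Zero R] {m : ℕ} (c : ℕ) (g : Finset (Fin m) → R) :
    Finset (Fin m) → R := fun I => if I.card = c then g I else 0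

theorem koszulD_cardPart {R : Type*} [CommRing R] {m : ℕ} (f : Fin m → R) (c : ℕ)
    (g : Finset (Fin m) → R) :
    koszulD f (cardPart (c + 1) g) = cardPart c (koszulD f g) := by
  funext J
  simp only [koszulD_apply, cardPart]
  split_ifs with h
  · refine Finset.sum_congr rfl fun j hj => ?_
    rw [Finset.card_insert_of_notMem (Finset.mem_compl.mp hj), if_pos (by omega)]
  · refine Finset.sum_eq_zero fun j hj => ?_
    rw [Finset.card_insert_of_notMem (Finset.mem_compl.mp hj), if_neg (by omega), mul_zero]

/-- Exactness of `F`. -/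
theorem exists_mem_termF_diff_eq (d : Fin (n + 1) → ℕ) (hd : ∀ i, 0 < d i) {i : ℕ}
    {g : Finset (Fin (n + 1)) → EffRing k n} (hg : g ∈ termF k n i) (h0 : diff k d g = 0)
    (hm : g ∅ ∈ Ideal.span (koszulElt k d '' (Finset.univ : Finset (Fin (n + 1))))) :
    ∃ h ∈ termF k n (i + 1), diff k d h = g := by
  obtain ⟨h, -, e⟩ := exists_koszulD_eq (koszulElt_regular d hd) Finset.univ g
    (fun I hI => absurd (Finset.subset_univ I) hI) h0 hm
  -- The preimage `h` may have components in every exterior degree; only degree `i + 1` contributes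
  -- to `g`.
  refine ⟨cardPart (i + 1) h, fun I hI => if_neg hI, ?_⟩
  refine (koszulD_cardPart _ i h).trans ?_
  rw [e]
  funext I
  simp only [cardPart]
  split_ifs with hI
  · rfl
  · exact (hg I hI).symm

/-! ### The augmentation -/

/-- The substitution `y_i ↦ x_i u ^ {d_i}` with values in `S[u]`. -/
def augPoly (k : Type*) [Field k] {n : ℕ} (d : Fin (n + 1) → ℕ) :
    EffRing k n →+* Polynomial (Cox k n) :=
  Polynomial.eval₂RingHom (MvPolynomial.eval₂Hom (Polynomial.C.comp MvPolynomial.C)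
    (Sum.elim (fun i => Polynomial.C (MvPolynomial.X i))
      (fun i => Polynomial.C (MvPolynomial.X i) * Polynomial.X ^ d i))) Polynomial.X

/-- The inclusion of `S[u]` in `S'[u]`. -/
def polyIncl (k : Type*) [Field k] (n : ℕ) : Polynomial (Cox k n) →+* EffRing k n :=
  Polynomial.mapRingHom (MvPolynomial.rename Sum.inl : Cox k n →ₐ[k] Cox₂ k n).toRingHom

theorem polyIncl_augPoly (d : Fin (n + 1) → ℕ) (p : EffRing k n) :
    polyIncl k n (augPoly k d p) = substHom k d Finset.univ p := by
  have : (polyIncl k n).comp (augPoly k d) = substHom k d Finset.univ := by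
    refine effRing_ringHom_ext (fun a => ?_) (fun i => ?_) (fun i => ?_) ?_
    · simp [polyIncl, augPoly]
    · rw [substHom_xv]; simp [polyIncl, augPoly, xv]
    · rw [substHom_yv]; simp [polyIncl, augPoly, xv, yv]
    · simp [polyIncl, augPoly]
  exact congr($this p)

theorem augPoly_polyIncl (d : Fin (n + 1) → ℕ) (q : Polynomial (Cox k n)) :
    augPoly k d (polyIncl k n q) = q := by
  have : (augPoly k d).comp (polyIncl k n) = RingHom.id _ := by
    refine Polynomial.ringHom_ext' (MvPolynomial.ringHom_ext (fun a => ?_) fun i => ?_) ?_ <;>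
    simp [polyIncl, augPoly]
  exact congr($this q)

theorem toLaurent_augPoly (d : Fin (n + 1) → ℕ) (g : Finset (Fin (n + 1)) → EffRing k n) :
    Polynomial.toLaurent (augPoly k d (g ∅)) = augValue d g := by
  have : Polynomial.toLaurent.comp (augPoly k d) =
      Polynomial.eval₂RingHom (shearRingHom k d) (LaurentPolynomial.T 1) := by
    refine effRing_ringHom_ext (fun a => ?_) (fun i => ?_) (fun i => ?_) ?_
    · simp [augPoly, shearRingHom]
    · simp [augPoly, shearRingHom, xv]
    · simp [augPoly, shearRingHom, yv]
    · simp [augPoly]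
  exact congr($this (g ∅))

theorem augPoly_koszulElt (d : Fin (n + 1) → ℕ) (i : Fin (n + 1)) :
    augPoly k d (koszulElt k d i) = 0 := by
  simp [augPoly, koszulElt, xv, yv]

theorem augValue_diff (d : Fin (n + 1) → ℕ) (g : Finset (Fin (n + 1)) → EffRing k n) :
    augValue d (diff k d g) = 0 := by
  rw [← toLaurent_augPoly]
  change Polynomial.toLaurent (augPoly k d (koszulD _ g ∅)) = 0
  rw [koszulD_apply, map_sum, Finset.sum_eq_zero, map_zero]
  intro j _
  rw [map_mul, map_mul, augPoly_koszulElt, mul_zero, zero_mul]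

theorem augValue_add (d : Fin (n + 1) → ℕ) (g h : Finset (Fin (n + 1)) → EffRing k n) :
    augValue d (g + h) = augValue d g + augValue d h :=
  Polynomial.eval₂_add _ _

theorem augValue_smul (d : Fin (n + 1) → ℕ) (r : Cox₂ k n)
    (g : Finset (Fin (n + 1)) → EffRing k n) :
    augValue d (r • g) = shearRingHom k d r * augValue d g := by
  simp only [augValue, Pi.smul_apply, Polynomial.smul_eq_C_mul, Polynomial.eval₂_mul,
    Polynomial.eval₂_C]

/-- Both `S[u] → S[t, t⁻¹]` and vanishing under the full substitution detect zero, so the kernel of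
the augmentation on `F_0` is the Koszul ideal. -/
theorem mem_span_of_augValue_eq_zero (d : Fin (n + 1) → ℕ)
    {g : Finset (Fin (n + 1)) → EffRing k n} (h : augValue d g = 0) :
    g ∅ ∈ Ideal.span (koszulElt k d '' (Finset.univ : Finset (Fin (n + 1)))) := by
  rw [← toLaurent_augPoly] at h
  have h' : augPoly k d (g ∅) = 0 := Polynomial.toLaurent_injective (by rw [h, map_zero])
  rw [← substHom_eq_zero_iff, ← polyIncl_augPoly, h', map_zero]

end Exactness

/-! ### The weight filtration and the comparison of `F'` with `F`. -/

section Weight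

variable {k : Type*} [Field k] {n : ℕ}

theorem coeff_diff (d : Fin (n + 1) → ℕ) (g : Finset (Fin (n + 1)) → EffRing k n)
    (J : Finset (Fin (n + 1))) (a : ℕ) :
    (diff k d g J).coeff a = ∑ j ∈ Jᶜ, (-1) ^ (J.filter (· < j)).card *
      (yv k j * (g (insert j J)).coeff a -
        xv k j * if d j ≤ a then (g (insert j J)).coeff (a - d j) else 0) := by
  change (koszulD _ g J).coeff a = _
  rw [koszulD_apply, Polynomial.finsetSum_coeff]
  refine Finset.sum_congr rfl fun j _ => ?_
  have hs : ((-1 : EffRing k n) ^ (J.filter (· < j)).card) =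
      Polynomial.C ((-1 : Cox₂ k n) ^ (J.filter (· < j)).card) := by simp
  rw [hs, mul_assoc, Polynomial.coeff_C_mul, koszulElt, sub_mul, Polynomial.coeff_sub,
    Polynomial.coeff_C_mul, mul_assoc, Polynomial.coeff_C_mul, Polynomial.coeff_X_pow_mul']

/-- The span of the `u ^ a e_I` with `a + b < m`, where `b = ∑_{l ∈ I} d_l`. -/
def weightLT (k : Type*) [Field k] {n : ℕ} (d : Fin (n + 1) → ℕ) (m : ℕ) :
    Submodule (Cox₂ k n) (Finset (Fin (n + 1)) → EffRing k n) where
  carrier := {g | ∀ I a, m ≤ a + ∑ l ∈ I, d l → (g I).coeff a = 0}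
  zero_mem' := fun I a _ => by simp
  add_mem' := fun {g h} hg hh I a hm => by simp [hg I a hm, hh I a hm]
  smul_mem' := fun r g hg I a hm => by simp [hg I a hm]

theorem mem_termF'_iff (d : Fin (n + 1) → ℕ) (i : ℕ) (g : Finset (Fin (n + 1)) → EffRing k n) :
    g ∈ termF' k d i ↔ g ∈ termF k n i ∧ g ∈ weightLT k d (∑ l, d l) := by
  constructor
  · exact fun hg => ⟨termF'_le_termF k d i hg, fun I a hm => by
      by_contra h
      exact absurd (hg I a h).2 (not_lt.mpr hm)⟩
  · rintro ⟨h₁, h₂⟩ I a h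
    refine ⟨?_, lt_of_not_ge fun hm => h (h₂ I a hm)⟩
    by_contra hI
    exact h (by rw [h₁ I hI, Polynomial.coeff_zero])

theorem weightLT_mono (d : Fin (n + 1) → ℕ) {m m' : ℕ} (h : m ≤ m') :
    weightLT k d m ≤ weightLT k d m' := fun _ hg I a hm => hg I a (h.trans hm)

/-- Removing `j` from `I` lowers `b` by `d j`; the factor `u^{d_j}` next to `x_j` restores this, and
nothing restores it next to `y_j`. -/
theorem diff_mem_weightLT (d : Fin (n + 1) → ℕ) {m : ℕ}
    {g : Finset (Fin (n + 1)) → EffRing k n} (hg : g ∈ weightLT k d m) :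
    diff k d g ∈ weightLT k d m := by
  intro J a hm
  rw [coeff_diff]
  refine Finset.sum_eq_zero fun j hj => ?_
  have hsum := Finset.sum_insert (f := d) (Finset.mem_compl.mp hj)
  rw [hg _ a (by omega)]
  split_ifs with h
  · rw [hg _ (a - d j) (by omega)]; simp
  · simp

theorem exists_mem_weightLT (d : Fin (n + 1) → ℕ) (m₀ : ℕ)
    (g : Finset (Fin (n + 1)) → EffRing k n) : ∃ e, g ∈ weightLT k d (m₀ + e) := by
  refine ⟨∑ I, ((g I).natDegree + 1 + ∑ l ∈ I, d l), fun I a hm => ?_⟩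
  have := Finset.single_le_sum (f := fun I => (g I).natDegree + 1 + ∑ l ∈ I, d l)
    (fun _ _ => Nat.zero_le _) (Finset.mem_univ I)
  exact Polynomial.coeff_eq_zero_of_natDegree_lt (by omega)

/-- The coefficients of the `u ^ a e_I` of weight `a + b = m`. -/
def weightPart (d : Fin (n + 1) → ℕ) (m : ℕ) (g : Finset (Fin (n + 1)) → EffRing k n) :
    Finset (Fin (n + 1)) → Cox₂ k n := fun J => (g J).coeff (m - ∑ l ∈ J, d l)

/-- The element of weight `m` with given coefficients. -/
def ofWeightPart (d : Fin (n + 1) → ℕ) (m : ℕ) (v : Finset (Fin (n + 1)) → Cox₂ k n) :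
    Finset (Fin (n + 1)) → EffRing k n :=
  fun J => Polynomial.monomial (m - ∑ l ∈ J, d l) (v J)

/-- This is what singles out the bound `w`: for `m ≥ w` the subtraction `m - b_J` is never
truncated, so weight `m` contains a full Koszul complex. -/
theorem sum_le_of_total_le (d : Fin (n + 1) → ℕ) {m : ℕ} (hm : ∑ l, d l ≤ m)
    (J : Finset (Fin (n + 1))) : ∑ l ∈ J, d l ≤ m :=
  (Finset.sum_le_sum_of_subset (Finset.subset_univ J)).trans hm

theorem ofWeightPart_mem_weightLT (d : Fin (n + 1) → ℕ) {m : ℕ} (hm : ∑ l, d l ≤ m)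
    (v : Finset (Fin (n + 1)) → Cox₂ k n) : ofWeightPart d m v ∈ weightLT k d (m + 1) := by
  intro I a ha
  have := sum_le_of_total_le d hm I
  exact Polynomial.coeff_monomial_of_ne _ (by omega)

theorem weightPart_ofWeightPart (d : Fin (n + 1) → ℕ) (m : ℕ)
    (v : Finset (Fin (n + 1)) → Cox₂ k n) : weightPart d m (ofWeightPart d m v) = v := by
  funext J
  exact Polynomial.coeff_monomial_same _ _

theorem weightPart_eq_zero (d : Fin (n + 1) → ℕ) {m : ℕ} (hm : ∑ l, d l ≤ m)
    {g : Finset (Fin (n + 1)) → EffRing k n} (hg : g ∈ weightLT k d m) :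
    weightPart d m g = 0 := by
  funext J
  have := sum_le_of_total_le d hm J
  exact hg J _ (by omega)

theorem mem_weightLT_of_weightPart_eq_zero (d : Fin (n + 1) → ℕ) {m : ℕ}
    {g : Finset (Fin (n + 1)) → EffRing k n} (hg : g ∈ weightLT k d (m + 1))
    (h : weightPart d m g = 0) : g ∈ weightLT k d m := by
  intro I a ha
  rcases ha.lt_or_eq with h' | h'
  · exact hg I a h'
  · have := congr_fun h I
    rwa [weightPart, h', Nat.add_sub_cancel] at this

/-- On top weight parts the differential is the Koszul differential of `-x₀, …, -xₙ`. -/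
theorem weightPart_diff (d : Fin (n + 1) → ℕ) (hd : ∀ i, 0 < d i) {m : ℕ} (hm : ∑ l, d l ≤ m)
    {g : Finset (Fin (n + 1)) → EffRing k n} (hg : g ∈ weightLT k d (m + 1)) :
    weightPart d m (diff k d g) = -koszulD (xv k) (weightPart d m g) := by
  funext J
  rw [weightPart, coeff_diff, Pi.neg_apply, koszulD_apply, ← Finset.sum_neg_distrib]
  refine Finset.sum_congr rfl fun j hj => ?_
  have hsum := Finset.sum_insert (f := d) (Finset.mem_compl.mp hj)
  have h₁ := sum_le_of_total_le d hm (insert j J)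
  have h₂ := hd j
  -- The coefficient multiplied by `y_j` has weight `m + d j > m`, hence vanishes; this needs `d j >
  -- 0`.
  rw [hg (insert j J) _ (by omega), if_pos (by omega), weightPart, hsum,
    show m - ∑ l ∈ J, d l - d j = m - (d j + ∑ l ∈ J, d l) by omega]
  ring

/-- After multiplication by a power of `x_l`, the summands of `F` of weight at least `w` can be
removed up to boundaries. -/
theorem exists_add_diff_of_mem_weightLT (d : Fin (n + 1) → ℕ) (hd : ∀ i, 0 < d i)
    (l : Fin (n + 1)) (i : ℕ) (e : ℕ) :
    ∀ h ∈ termF k n i, h ∈ weightLT k d (∑ l, d l + e) →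
      diff k d h ∈ weightLT k d (∑ l, d l) →
      ∃ N, ∃ h' ∈ termF' k d i, ∃ H ∈ termF k n (i + 1), xv k l ^ N • h = h' + diff k d H := by
  induction e with
  | zero =>
    intro h hi hw _
    exact ⟨0, h, (mem_termF'_iff d i h).mpr ⟨hi, hw⟩, 0, zero_mem _, by simp⟩
  | succ e ih =>
    intro h hi hw hD
    set m := ∑ l, d l + e with hm_def
    have hm : ∑ l, d l ≤ m := Nat.le_add_right _ _
    set v := weightPart d m h with hv
    -- The boundary of `h` has weight below `w ≤ m`, so its part of weight `m` is zero.
    have hDv : koszulD (xv k) v = 0 := by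
      rw [← neg_eq_zero, hv, ← weightPart_diff d hd hm hw]
      exact weightPart_eq_zero d hm (weightLT_mono d hm hD)
    have hvi : ∀ I, I.card ≠ i → v I = 0 := fun I hI => by
      rw [hv, weightPart, hi I hI, Polynomial.coeff_zero]
    -- For the Koszul differential of the `x_i`, the cycle `xv k l • v` bounds `e_l ∧ v`. By the
    -- sign in `weightPart_diff`, adding `diff k d H` cancels the top weight of `xv k l • h`.
    set H := ofWeightPart d m (wedge l v) with hH
    have hHi : H ∈ termF k n (i + 1) := by
      intro I hI
      have : wedge l v I = 0 := by
        rw [wedge_apply]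
        split_ifs with hl
        · rw [hvi, mul_zero]
          have := Finset.card_erase_add_one hl
          omega
        · rfl
      rw [hH, ofWeightPart, this, Polynomial.monomial_zero_right]
    have hHw := ofWeightPart_mem_weightLT d hm (wedge l v)
    have h1i : xv k l • h + diff k d H ∈ termF k n i :=
      add_mem (Submodule.smul_mem _ _ hi) (diff_mem_termF d i H hHi)
    have h1w : xv k l • h + diff k d H ∈ weightLT k d m := by
      refine mem_weightLT_of_weightPart_eq_zero d
        (add_mem (Submodule.smul_mem _ _ hw) (diff_mem_weightLT d hHw)) ?_
      have h₁ := weightPart_diff d hd hm hHw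
      rw [weightPart_ofWeightPart] at h₁
      have h₂ := koszulD_wedge (xv k) l v
      rw [hDv, map_zero, add_zero] at h₂
      rw [h₂] at h₁
      have h₃ : weightPart d m (xv k l • h + diff k d H) =
          xv k l • v + weightPart d m (diff k d H) := by
        funext J
        simp [weightPart, hv]
      rw [h₃, hH, h₁, add_neg_cancel]
    have hDD : diff k d (diff k d H) = 0 := koszulD_koszulD _ _
    obtain ⟨N, h', hh', H', hH', e'⟩ := ih _ h1i h1w (by
      rw [map_add, map_smul, hDD, add_zero]
      exact Submodule.smul_mem _ _ hD)
    refine ⟨N + 1, h', hh', H' - xv k l ^ N • H,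
      sub_mem hH' (Submodule.smul_mem _ _ hHi), ?_⟩
    rw [map_sub, map_smul, pow_succ, mul_smul, ← add_sub_assoc, ← e', smul_add,
      add_sub_cancel_right]

theorem exists_add_diff (d : Fin (n + 1) → ℕ) (hd : ∀ i, 0 < d i) (l : Fin (n + 1)) {i : ℕ}
    {h : Finset (Fin (n + 1)) → EffRing k n} (hi : h ∈ termF k n i)
    (hD : diff k d h ∈ weightLT k d (∑ l, d l)) :
    ∃ N, ∃ h' ∈ termF' k d i, ∃ H ∈ termF k n (i + 1), xv k l ^ N • h = h' + diff k d H := by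
  obtain ⟨e, he⟩ := exists_mem_weightLT d (∑ l, d l) h
  exact exists_add_diff_of_mem_weightLT d hd l i e h hi he hD

/-- A primitive of `g` exists in `F`. Its boundary `g` already has weight below `w`, so a power of
`x_l` times it lies in `F'` up to a boundary, which `diff` kills. -/
theorem exists_mem_termF'_diff_eq (d : Fin (n + 1) → ℕ) (hd : ∀ i, 0 < d i) {i : ℕ}
    {g : Finset (Fin (n + 1)) → EffRing k n} (hg : g ∈ termF' k d i) (h0 : diff k d g = 0)
    (hm : g ∅ ∈ Ideal.span (koszulElt k d '' (Finset.univ : Finset (Fin (n + 1)))))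
    (l : Fin (n + 1)) : ∃ N, ∃ h ∈ termF' k d (i + 1), diff k d h = xv k l ^ N • g := by
  rw [mem_termF'_iff] at hg
  obtain ⟨h, hh, e⟩ := exists_mem_termF_diff_eq d hd hg.1 h0 hm
  obtain ⟨N, h', hh', H, -, e'⟩ := exists_add_diff d hd l hh (by rw [e]; exact hg.2)
  refine ⟨N, h', hh', ?_⟩
  have hDD : diff k d (diff k d H) = 0 := koszulD_koszulD _ _
  rw [← e, ← map_smul, e', map_add, hDD, add_zero]

theorem exists_diff_eq_of_diff_eq_zero (d : Fin (n + 1) → ℕ) (hd : ∀ i, 0 < d i) {i : ℕ}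
    {g : Finset (Fin (n + 1)) → EffRing k n} (hg : g ∈ termF' k d (i + 1)) (h0 : diff k d g = 0)
    (l : Fin (n + 1)) : ∃ N, ∃ h ∈ termF' k d (i + 2), diff k d h = xv k l ^ N • g := by
  refine exists_mem_termF'_diff_eq d hd hg h0 ?_ l
  rw [termF'_le_termF k d _ hg ∅ (by simp)]
  exact zero_mem _

theorem diff_eq_zero_of_mem_termF_zero (d : Fin (n + 1) → ℕ)
    {g : Finset (Fin (n + 1)) → EffRing k n} (hg : g ∈ termF k n 0) : diff k d g = 0 := by
  funext J
  change koszulD _ g J = 0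
  rw [koszulD_apply]
  refine Finset.sum_eq_zero fun j hj => ?_
  rw [hg _ (by simp), mul_zero]

theorem exists_diff_eq_of_augValue_eq_zero (d : Fin (n + 1) → ℕ) (hd : ∀ i, 0 < d i)
    {g : Finset (Fin (n + 1)) → EffRing k n} (hg : g ∈ termF' k d 0) (h0 : augValue d g = 0)
    (l : Fin (n + 1)) : ∃ N, ∃ h ∈ termF' k d 1, diff k d h = xv k l ^ N • g :=
  exists_mem_termF'_diff_eq d hd hg
    (diff_eq_zero_of_mem_termF_zero d (termF'_le_termF k d 0 hg))
    (mem_span_of_augValue_eq_zero d h0) l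

theorem shearRingHom_yv (d : Fin (n + 1) → ℕ) (j : Fin (n + 1)) :
    shearRingHom k d (yv k j) =
      LaurentPolynomial.C (MvPolynomial.X j) * LaurentPolynomial.T (d j) := by
  simp [shearRingHom, yv]

/-- A power of `y_j` makes `s` polynomial in `t`, so it lifts to `F_0`; a power of `x_i` then moves
the lift into `F'_0`. -/
theorem exists_augValue_eq (d : Fin (n + 1) → ℕ) (hd : ∀ i, 0 < d i) (s : DiagRing k n)
    (i j : Fin (n + 1)) : ∃ N, ∃ g ∈ termF' k d 0,
      augValue d g = shearRingHom k d ((xv k i * yv k j) ^ N) * s := by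
  obtain ⟨M, p, hp⟩ := LaurentPolynomial.exists_T_pow s
  obtain ⟨q, hq⟩ : ∃ q : Polynomial (Cox k n),
      Polynomial.toLaurent q = shearRingHom k d (yv k j ^ M) * s := by
    -- Here `p = s t^M`, while `y_j^M ↦ x_j^M t^{d_j M}`: of these powers of `t`, `M` are absorbed
    -- in `p` and `(d_j - 1) M` remain.
    refine ⟨Polynomial.C (MvPolynomial.X j ^ M) * Polynomial.X ^ ((d j - 1) * M) * p, ?_⟩
    rw [map_mul, map_mul, hp, map_pow (shearRingHom k d), shearRingHom_yv, mul_pow, LaurentPolynomial.T_pow,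
      Polynomial.toLaurent_C, Polynomial.toLaurent_X_pow, map_pow]
    have : (LaurentPolynomial.T ((M : ℤ) * (d j : ℤ)) : DiagRing k n) =
        LaurentPolynomial.T (((d j - 1) * M : ℕ) : ℤ) * LaurentPolynomial.T (M : ℤ) := by
      rw [← LaurentPolynomial.T_add]
      congr 1
      have := hd j
      push_cast [Nat.cast_sub (show 1 ≤ d j from this)]
      ring
    rw [this]
    ring
  let h : Finset (Fin (n + 1)) → EffRing k n := Pi.single ∅ (polyIncl k n q)
  have hh : h ∈ termF k n 0 := fun I hI => Pi.single_eq_of_ne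
    (fun e => hI (by rw [e, Finset.card_empty])) _
  have hv : augValue d h = shearRingHom k d (yv k j ^ M) * s := by
    rw [← toLaurent_augPoly, ← hq]
    simp only [h, Pi.single_eq_same, augPoly_polyIncl]
  obtain ⟨N, h', hh', H, -, e⟩ := exists_add_diff d hd i hh (by
    rw [diff_eq_zero_of_mem_termF_zero d hh]; exact zero_mem _)
  -- The value of `h'` carries `x_i^N y_j^M`; the extra factor makes both exponents `N + M`.
  refine ⟨N + M, (xv k i ^ M * yv k j ^ N) • h', Submodule.smul_mem _ _ hh', ?_⟩
  have e' := congr_arg (augValue d) e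
  rw [augValue_add, augValue_diff, add_zero, augValue_smul, hv] at e'
  rw [augValue_smul, ← e', ← mul_assoc, ← mul_assoc, ← map_mul, ← map_mul]
  congr 2
  ring

end Weight

/-! ### The basis of `F'`, its length, and bihomogeneity. -/

section Grading

variable {k : Type*} [Field k] {n : ℕ}

instance (d : Fin (n + 1) → ℕ) (i : ℕ) : Finite (Gen d i) := by
  refine Finite.of_injective (β := Fin (∑ l, d l) × Finset (Fin (n + 1)))
    (fun p => (⟨p.1.1, by have := p.2.2; omega⟩, p.1.2)) fun p q h => ?_
  simp only [Prod.mk.injEq, Fin.mk.injEq] at h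
  exact Subtype.ext (Prod.ext h.1 h.2)

open Classical in
/-- Elements of `F'_i` as families of coefficients. -/
def coeffEquiv (k : Type*) [Field k] {n : ℕ} (d : Fin (n + 1) → ℕ) (i : ℕ) :
    termF' k d i ≃ₗ[Cox₂ k n] (Gen d i → Cox₂ k n) where
  toFun g p := (g.1 p.1.2).coeff p.1.1
  map_add' g h := by funext p; simp
  map_smul' r g := by funext p; simp
  invFun v := ⟨fun I => ∑ a ∈ Finset.range (∑ l, d l), Polynomial.monomial a
      (if h : I.card = i ∧ a + ∑ l ∈ I, d l < ∑ l, d l then v ⟨(a, I), h⟩ else 0), by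
    intro I a h
    by_contra hn
    apply h
    rw [Polynomial.finsetSum_coeff]
    refine Finset.sum_eq_zero fun b _ => ?_
    rw [Polynomial.coeff_monomial]
    split_ifs with hb hb'
    · exact absurd (hb ▸ hb') hn
    · rfl
    · rfl⟩
  left_inv g := by
    refine Subtype.ext (funext fun I => Polynomial.ext fun a => ?_)
    simp only [Polynomial.finsetSum_coeff, Polynomial.coeff_monomial, Finset.sum_ite_eq',
      Finset.mem_range]
    by_cases h : (g.1 I).coeff a = 0
    · rw [h]; simp
    · have := g.2 I a h
      rw [if_pos (by omega), dif_pos this]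
  right_inv v := by
    funext p
    have := p.2
    simp only [Polynomial.finsetSum_coeff, Polynomial.coeff_monomial, Finset.sum_ite_eq',
      Finset.mem_range]
    rw [if_pos (by omega), dif_pos this]
    rfl

theorem coeffEquiv_apply (d : Fin (n + 1) → ℕ) (i : ℕ) (g : termF' k d i) (p : Gen d i) :
    coeffEquiv k d i g p = (g.1 p.1.2).coeff p.1.1 := rfl

/-- The basis of the `u ^ a e_I`. -/
def termF'Basis (k : Type*) [Field k] {n : ℕ} (d : Fin (n + 1) → ℕ) (i : ℕ) :
    Module.Basis (Gen d i) (Cox₂ k n) (termF' k d i) :=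
  Module.Basis.ofEquivFun (coeffEquiv k d i)

theorem termF'Basis_apply (d : Fin (n + 1) → ℕ) (i : ℕ) (p : Gen d i) :
    (termF'Basis k d i p).1 = Pi.single p.1.2 (Polynomial.X ^ p.1.1) := by
  classical
  have hmem : (Pi.single p.1.2 (Polynomial.X ^ p.1.1) :
      Finset (Fin (n + 1)) → EffRing k n) ∈ termF' k d i := by
    intro I a h
    by_cases hI : I = p.1.2
    · subst hI
      rw [Pi.single_eq_same, Polynomial.coeff_X_pow] at h
      have : a = p.1.1 := by_contra fun hn => h (if_neg hn)
      rw [this]; exact p.2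
    · rw [Pi.single_eq_of_ne hI] at h
      simp at h
  suffices h : termF'Basis k d i p = ⟨_, hmem⟩ by rw [h]
  rw [termF'Basis, Module.Basis.coe_ofEquivFun, LinearEquiv.symm_apply_eq]
  funext q
  rw [coeffEquiv_apply]
  by_cases hq : q = p
  · subst hq; simp
  · rw [Pi.single_eq_of_ne hq]
    by_cases hI : q.1.2 = p.1.2
    · have : q.1.1 ≠ p.1.1 := fun h => hq (Subtype.ext (Prod.ext h hI))
      simp [hI, Polynomial.coeff_X_pow, this]
    · simp [Pi.single_eq_of_ne hI]

/-- Only `I = univ` could occur, and then `b = w` leaves no `a ≥ 0` with `a + b < w`. -/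
theorem subsingleton_termF' (d : Fin (n + 1) → ℕ) {i : ℕ} (hi : n < i) :
    Subsingleton (termF' k d i) := by
  refine subsingleton_of_forall_eq 0 fun g => Subtype.ext (funext fun I => Polynomial.ext fun a => ?_)
  by_contra h
  obtain ⟨h₁, h₂⟩ := g.2 I a h
  have : I = Finset.univ := by
    rw [← Finset.card_eq_iff_eq_univ, Fintype.card_fin]
    have := Finset.card_le_univ I
    rw [Fintype.card_fin] at this
    omega
  subst this
  omega

/-- Both `y_j` and `x_j u^{d_j}` have bidegree `(0, d_j)`, which is what `e_I` loses when `j` is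
removed. -/
theorem isHomog_diff (d : Fin (n + 1) → ℕ) (χ : ℤ × ℤ)
    {g : Finset (Fin (n + 1)) → EffRing k n} (hg : IsHomog d χ g) : IsHomog d χ (diff k d g) := by
  intro J a
  rw [coeff_diff, ← MvPolynomial.mem_weightedHomogeneousSubmodule]
  refine Submodule.sum_mem _ fun j hj => ?_
  have hsum := Finset.sum_insert (f := fun l => (d l : ℤ)) (Finset.mem_compl.mp hj)
  have hy : yv k j * (g (insert j J)).coeff a ∈ MvPolynomial.weightedHomogeneousSubmodule k
      (bideg d) (χ - (-(a : ℤ), (a : ℤ) + ∑ l ∈ J, (d l : ℤ))) := by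
    rw [MvPolynomial.mem_weightedHomogeneousSubmodule]
    convert (MvPolynomial.isWeightedHomogeneous_X k (bideg d) (Sum.inr j)).mul
      (hg (insert j J) a) using 1
    · rfl
    rw [hsum]
    ext <;> simp [bideg]
    ring
  have hx : (xv k j * if d j ≤ a then (g (insert j J)).coeff (a - d j) else 0) ∈
      MvPolynomial.weightedHomogeneousSubmodule k
      (bideg d) (χ - (-(a : ℤ), (a : ℤ) + ∑ l ∈ J, (d l : ℤ))) := by
    split_ifs with h
    · rw [MvPolynomial.mem_weightedHomogeneousSubmodule]
      convert (MvPolynomial.isWeightedHomogeneous_X k (bideg d) (Sum.inl j)).mul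
        (hg (insert j J) (a - d j)) using 1
      · rfl
      rw [hsum]
      ext <;> simp [bideg, Nat.cast_sub h] <;> ring
    · rw [mul_zero]; exact zero_mem _
  rcases neg_one_pow_eq_or (Cox₂ k n) (J.filter (· < j)).card with h | h
  · rw [h, one_mul]; exact sub_mem hy hx
  · rw [h, neg_one_mul]; exact neg_mem (sub_mem hy hx)

theorem isHomog_zero (d : Fin (n + 1) → ℕ) (χ : ℤ × ℤ) :
    IsHomog d χ (0 : Finset (Fin (n + 1)) → EffRing k n) := fun _ _ =>
  MvPolynomial.isWeightedHomogeneous_zero _ _ _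

theorem HasWeight.add {d : Fin (n + 1) → ℕ} {χ : ℤ × ℤ} {s t : DiagRing k n}
    (hs : HasWeight d χ s) (ht : HasWeight d χ t) : HasWeight d χ (s + t) := by
  obtain ⟨f, hf, rfl⟩ := hs
  obtain ⟨g, hg, rfl⟩ := ht
  exact ⟨f + g, hf.add hg, by rw [map_add, add_mul]⟩

theorem HasWeight.zero (d : Fin (n + 1) → ℕ) (χ : ℤ × ℤ) : HasWeight d χ (0 : DiagRing k n) :=
  ⟨0, MvPolynomial.isWeightedHomogeneous_zero _ _ _, by simp⟩

theorem HasWeight.sum {d : Fin (n + 1) → ℕ} {χ : ℤ × ℤ} {ι : Type*} (t : Finset ι)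
    (f : ι → DiagRing k n) (h : ∀ a ∈ t, HasWeight d χ (f a)) :
    HasWeight d χ (∑ a ∈ t, f a) :=
  Finset.sum_induction f (HasWeight d χ) (fun _ _ => HasWeight.add) (HasWeight.zero d χ) h

theorem HasWeight.mul {d : Fin (n + 1) → ℕ} {χ ψ : ℤ × ℤ} {s t : DiagRing k n}
    (hs : HasWeight d χ s) (ht : HasWeight d ψ t) : HasWeight d (χ + ψ) (s * t) := by
  obtain ⟨f, hf, rfl⟩ := hs
  obtain ⟨g, hg, rfl⟩ := ht
  refine ⟨f * g, ?_, ?_⟩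
  · convert hf.mul hg using 1
    simp only [Prod.fst_add, Prod.snd_add]
    ring
  · rw [map_mul, Prod.snd_add, LaurentPolynomial.T_add]
    ring

/-- Leaving `χ` existential lets the induction add one variable at a time; a nonzero coefficient
later identifies it. -/
theorem hasWeight_shearRingHom_monomial (d : Fin (n + 1) → ℕ)
    (m : Fin (n + 1) ⊕ Fin (n + 1) →₀ ℕ) (a : k) :
    ∃ χ, MvPolynomial.IsWeightedHomogeneous (bideg d) (MvPolynomial.monomial m a) χ ∧
      HasWeight d χ (shearRingHom k d (MvPolynomial.monomial m a)) := by
  refine MvPolynomial.induction_on_monomial (motive := fun c => ∃ χ,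
    MvPolynomial.IsWeightedHomogeneous (bideg d) c χ ∧ HasWeight d χ (shearRingHom k d c))
    (fun a => ?_) ?_ m a
  · refine ⟨0, MvPolynomial.isWeightedHomogeneous_C _ _, MvPolynomial.C a,
      by simpa using MvPolynomial.isWeightedHomogeneous_C _ _, ?_⟩
    simp [shearRingHom]
  · rintro c i ⟨χ, h₁, h₂⟩
    refine ⟨χ + bideg d i, h₁.mul (MvPolynomial.isWeightedHomogeneous_X _ _ _), ?_⟩
    rw [map_mul]
    refine h₂.mul ⟨?_, ?_⟩
    · exact MvPolynomial.X (Sum.elim id id i)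
    · cases i with
      | inl i =>
        refine ⟨?_, by simp [shearRingHom, bideg]⟩
        simpa [bideg] using MvPolynomial.isWeightedHomogeneous_X k (fun i => (d i : ℤ)) i
      | inr i =>
        refine ⟨?_, by simp [shearRingHom, bideg]⟩
        simpa [bideg] using MvPolynomial.isWeightedHomogeneous_X k (fun i => (d i : ℤ)) i

theorem hasWeight_shearRingHom (d : Fin (n + 1) → ℕ) {χ : ℤ × ℤ} {c : Cox₂ k n}
    (hc : MvPolynomial.IsWeightedHomogeneous (bideg d) c χ) :
    HasWeight d χ (shearRingHom k d c) := by
  rw [← c.support_sum_monomial_coeff, map_sum]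
  refine HasWeight.sum _ _ fun m hm => ?_
  obtain ⟨ψ, h₁, h₂⟩ := hasWeight_shearRingHom_monomial d m (c.coeff m)
  rw [MvPolynomial.mem_support_iff] at hm
  have e₁ := hc hm
  have e₂ := h₁ (d := m) (by rwa [MvPolynomial.coeff_monomial, if_pos rfl])
  rwa [← e₁, e₂]

theorem hasWeight_augValue (d : Fin (n + 1) → ℕ) (χ : ℤ × ℤ)
    {g : Finset (Fin (n + 1)) → EffRing k n} (hg : IsHomog d χ g) :
    HasWeight d χ (augValue d g) := by
  rw [augValue, Polynomial.eval₂_eq_sum]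
  refine HasWeight.sum _ _ fun a _ => ?_
  have h := hasWeight_shearRingHom d (hg ∅ a)
  have ht : HasWeight d (-(a : ℤ), (a : ℤ)) ((LaurentPolynomial.T 1 : DiagRing k n) ^ a) :=
    ⟨1, by simpa using MvPolynomial.isWeightedHomogeneous_one k _, by
      simp [LaurentPolynomial.T_pow]⟩
  convert h.mul ht using 1
  simp

end Grading

/-! ### Exactness of `M ↦ M~` on an open subset, and pushforwards of structure sheaves. -/

section Sheaves

open Limits TopologicalSpace

universe u

instance (A : CommRingCat.{u}) (V : (Spec A).Opens) : (restrictedTilde A V).IsLeftAdjoint := by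
  unfold restrictedTilde; infer_instance

instance (A : CommRingCat.{u}) (V : (Spec A).Opens) : (restrictedTilde A V).Additive :=
  have := preservesBinaryBiproducts_of_preservesBinaryCoproducts (restrictedTilde A V)
  Functor.additive_of_preservesBinaryBiproducts _

theorem mono_of_injective_app {X : Scheme.{u}} {M N : X.Modules} (f : M ⟶ N)
    (h : ∀ U, Function.Injective (f.app U)) : Mono f where
  right_cancellation g g' e := by
    ext U x
    apply h U
    exact congr(($e).app U x)

/-- Sections of `M~` are families of elements of the localizations of `M`, and localization
preserves injectivity. -/
theorem tilde_map_app_injective {A : CommRingCat.{u}} {M N : ModuleCat A} (f : M ⟶ N)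
    (hf : Function.Injective f) (U : (Spec A).Opens) :
    Function.Injective ((tilde.map f).app U) := by
  intro s t h
  refine Subtype.ext (funext fun p => ?_)
  have h' := congr_fun (congr_arg Subtype.val h) p
  let q : PrimeSpectrum A := p.1
  exact IsLocalizedModule.map_injective q.asIdeal.primeCompl
    (LocalizedModule.mkLinearMap q.asIdeal.primeCompl M)
    (LocalizedModule.mkLinearMap q.asIdeal.primeCompl N) f.hom hf h'

theorem restrictedTilde_map_mono {A : CommRingCat.{u}} (V : (Spec A).Opens) {M N : ModuleCat A}
    (f : M ⟶ N) [Mono f] : Mono ((restrictedTilde A V).map f) :=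
  mono_of_injective_app _ fun U =>
    tilde_map_app_injective f ((ModuleCat.mono_iff_injective f).mp inferInstance) (V.ι ''ᵁ U)

instance (A : CommRingCat.{u}) (V : (Spec A).Opens) :
    (restrictedTilde A V).PreservesHomology := by
  -- Right exactness comes from being a left adjoint; preservation of monomorphisms supplies the
  -- rest.
  refine ((Functor.exact_tfae (restrictedTilde A V)).out 0 2 rfl rfl).mp fun S hS => ?_
  have h := ((Functor.preservesFiniteColimits_tfae (restrictedTilde A V)).out 3 0 rfl rfl).mp
    inferInstance S hS
  have := hS.mono_f
  have hm := restrictedTilde_map_mono V S.f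
  have := h.2
  exact { exact := h.1, mono_f := hm, epi_g := h.2 }

theorem isZero_of_subsingleton {X : Scheme.{u}} (M : X.Modules)
    (h : ∀ U, Subsingleton Γ(M, U)) : IsZero M := by
  rw [IsZero.iff_id_eq_zero]
  ext U x
  exact Subsingleton.elim _ _

theorem restrictedTilde_isZero {A : CommRingCat.{u}} (V : (Spec A).Opens) (M : ModuleCat A)
    (h : ∀ p ∈ V, ∀ m : M, ∃ r ∉ p.asIdeal, r • m = 0) :
    IsZero ((restrictedTilde A V).obj M) := by
  refine isZero_of_subsingleton _ fun U => ⟨fun s t => ?_⟩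
  refine Subtype.ext (funext fun p => ?_)
  have hp : p.1 ∈ V := by
    obtain ⟨q, hq, e⟩ := p.2
    rw [← e]; exact q.2
  let q : PrimeSpectrum A := p.1
  have : Subsingleton (LocalizedModule q.asIdeal.primeCompl M) := by
    rw [LocalizedModule.subsingleton_iff]
    intro m
    obtain ⟨r, hr, h0⟩ := h q hp m
    exact ⟨r, hr, h0⟩
  exact this.elim _ _

/-- The functor commutes with homology, and the hypothesis says that the homology module has zero
localization at every point of `V`. -/
theorem restrictedTilde_map_exact {A : CommRingCat.{u}} (V : (Spec A).Opens)
    (S : ShortComplex (ModuleCat A))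
    (h : ∀ p ∈ V, ∀ m : S.X₂, S.g m = 0 → ∃ r ∉ p.asIdeal, ∃ l : S.X₁, S.f l = r • m) :
    (S.map (restrictedTilde A V)).Exact := by
  rw [ShortComplex.exact_iff_isZero_homology]
  refine IsZero.of_iso ?_ (S.mapHomologyIso (restrictedTilde A V))
  refine restrictedTilde_isZero V _ fun p hp z => ?_
  obtain ⟨z, rfl⟩ := (ModuleCat.epi_iff_surjective S.homologyπ).mp inferInstance z
  obtain ⟨r, hr, l, hl⟩ := h p hp (S.iCycles z) (by
    rw [← ModuleCat.comp_apply, S.iCycles_g]; rfl)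
  refine ⟨r, hr, ?_⟩
  have : r • z = S.toCycles l := by
    apply (ModuleCat.mono_iff_injective S.iCycles).mp inferInstance
    rw [← ModuleCat.comp_apply, S.toCycles_i, hl, map_smul]
  rw [← map_smul, this, ← ModuleCat.comp_apply, S.toCycles_comp_homologyπ]
  rfl

theorem presheaf_map_map_eq (X : Scheme.{u}) {U V V' W : (X.Opens)ᵒᵖ} (a : U ⟶ V) (b : V ⟶ W)
    (a' : U ⟶ V') (b' : V' ⟶ W) (x : X.presheaf.obj U) :
    X.presheaf.map b (X.presheaf.map a x) = X.presheaf.map b' (X.presheaf.map a' x) := by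
  rw [← ConcreteCategory.comp_apply, ← ConcreteCategory.comp_apply, ← Functor.map_comp,
    ← Functor.map_comp]
  rfl

/-- Base change of the pushforward of the structure sheaf to an open subscheme. -/
def restrictPushforwardUnitIso {X Y : Scheme.{u}} (f : X ⟶ Y) (V : Y.Opens) :
    (Scheme.Modules.restrictFunctor V.ι).obj
      ((Scheme.Modules.pushforward f).obj (SheafOfModules.unit _ : X.Modules)) ≅
    (Scheme.Modules.pushforward (f ∣_ V)).obj
      (SheafOfModules.unit _ : (f ⁻¹ᵁ V).toScheme.Modules) := by
  -- Over each `U` both sides are functions on the same open subset of `X`, written in two ways;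
  -- linearity and naturality remain.
  refine (Scheme.Modules.fullyFaithfulToPresheafOfModules).preimageIso <|
    PresheafOfModules.isoMk (fun U => ?_) ?_
  · refine ModuleCat.isoMk
      ((forget₂ CommRingCat RingCat ⋙ forget₂ _ Ab).mapIso (X.presheaf.mapIso
        (eqToIso (image_morphismRestrict_preimage f V U.unop)).op)) ?_
    intro (r : Γ(V, U.unop))
    ext (x : Γ(X, f ⁻¹ᵁ (V.ι ''ᵁ U.unop)))
    change (f ∣_ V).app U.unop r * (show Γ(f ⁻¹ᵁ V, (f ∣_ V) ⁻¹ᵁ U.unop) from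
        X.presheaf.map (eqToHom (image_morphismRestrict_preimage f V U.unop)).op x) =
      X.presheaf.map (eqToHom (image_morphismRestrict_preimage f V U.unop)).op
        (f.app _ ((V.ι.appIso U.unop).inv r) * x)
    rw [map_mul, morphismRestrict_app, Scheme.Opens.ι_appIso]
    rfl
  · intro U W g
    ext x
    exact presheaf_map_map_eq X _ _ _ _ x

theorem restrictPushforwardUnitIso_hom_app {X Y : Scheme.{u}} (f : X ⟶ Y) (V : Y.Opens)
    (U : V.toScheme.Opens) (x : Γ(X, f ⁻¹ᵁ (V.ι ''ᵁ U))) :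
    (restrictPushforwardUnitIso f V).hom.app U x =
      X.presheaf.map (eqToHom (image_morphismRestrict_preimage f V U)).op x :=
  rfl

/-- The global functions on `Spec B` as a module over `A`. -/
abbrev sectionsModule {A B : CommRingCat.{u}} (φ : A ⟶ B) : ModuleCat A :=
  (modulesSpecToSheaf.obj ((Scheme.Modules.pushforward (Spec.map φ)).obj
    (SheafOfModules.unit _ : (Spec B).Modules))).presheaf.obj (.op ⊤)

/-- Scalars act through global functions on `Spec A`; naturality of `ΓSpecIso` identifies their
pullback with `φ`. -/
theorem sectionsModule_smul {A B : CommRingCat.{u}} (φ : A ⟶ B) (a : A) (x : Γ(Spec B, ⊤)) :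
    (a • (show sectionsModule φ from x) : sectionsModule φ) =
      (show sectionsModule φ from ((Scheme.ΓSpecIso B).inv.hom (φ.hom a) * x : Γ(Spec B, ⊤))) := by
  change (Spec.map φ).appTop ((Scheme.ΓSpecIso A).inv.hom a) * x = _
  have := congr(($(Scheme.ΓSpecIso_inv_naturality φ)).hom a)
  exact congr($this.symm * x)

theorem isIso_fromTildeΓ_pushforward_unit {A B : CommRingCat.{u}} (φ : A ⟶ B) :
    IsIso ((Scheme.Modules.pushforward (Spec.map φ)).obj
      (SheafOfModules.unit _ : (Spec B).Modules)).fromTildeΓ :=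
  isIso_fromTildeΓ_pushforward φ _

/-- The sheaf on `V ⊆ Spec A` associated with the `A`-algebra `B` is the pushforward of the
structure sheaf along `Spec B ×_{Spec A} V ⟶ V`. -/
def restrictedTildeSectionsIso {A B : CommRingCat.{u}} (φ : A ⟶ B) (V : (Spec A).Opens) :
    (restrictedTilde A V).obj (sectionsModule φ) ≅
      (Scheme.Modules.pushforward (Spec.map φ ∣_ V)).obj
        (SheafOfModules.unit _ : (Spec.map φ ⁻¹ᵁ V).toScheme.Modules) :=
  (Scheme.Modules.restrictFunctor V.ι).mapIso
    (@asIso _ _ _ _ _ (isIso_fromTildeΓ_pushforward_unit φ)) ≪≫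
    restrictPushforwardUnitIso (Spec.map φ) V

theorem restrictedTilde_map_app_toOpen {A : CommRingCat.{u}} (V : (Spec A).Opens)
    {M N : ModuleCat A} (f : M ⟶ N) (m : M) :
    ((restrictedTilde A V).map f).app ⊤ ((tilde.toOpen M (V.ι ''ᵁ ⊤)).hom m) =
      (tilde.toOpen N (V.ι ''ᵁ ⊤)).hom (f m) :=
  congr(($(tilde.toOpen_map_app f (V.ι ''ᵁ ⊤))).hom m)

theorem restrictedTildeSectionsIso_hom_app_toOpen {A B : CommRingCat.{u}} (φ : A ⟶ B)
    (V : (Spec A).Opens) (x : Γ(Spec B, ⊤)) :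
    (restrictedTildeSectionsIso φ V).hom.app ⊤
      ((tilde.toOpen (sectionsModule φ) (V.ι ''ᵁ ⊤)).hom x) =
    (show Γ((Scheme.Modules.pushforward (Spec.map φ ∣_ V)).obj
        (SheafOfModules.unit _ : (Spec.map φ ⁻¹ᵁ V).toScheme.Modules), ⊤) from
      (Spec.map φ ⁻¹ᵁ V).ι.appTop.hom x) := by
  have h := congr(($(((Scheme.Modules.pushforward (Spec.map φ)).obj
      (SheafOfModules.unit _ : (Spec B).Modules)).toOpen_fromTildeΓ_app (V.ι ''ᵁ ⊤))).hom x)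
  change (restrictPushforwardUnitIso (Spec.map φ) V).hom.app ⊤
    (((Scheme.Modules.pushforward (Spec.map φ)).obj
      (SheafOfModules.unit _ : (Spec B).Modules)).fromTildeΓ.app (V.ι ''ᵁ ⊤) _) = _
  refine (congrArg _ h).trans ?_
  refine (restrictPushforwardUnitIso_hom_app _ _ _ _).trans ?_
  change (Spec B).presheaf.map _ ((Spec B).presheaf.map (homOfLE (le_top :
    Spec.map φ ⁻¹ᵁ (V.ι ''ᵁ ⊤) ≤ ⊤)).op x) = _
  rw [← ConcreteCategory.comp_apply, ← Functor.map_comp]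
  rfl

/-! ### The augmented complex on the atlas. -/

section Resolution

variable {k : Type u} [Field k] {n : ℕ}

theorem mem_atlas {p : Spec (CommRingCat.of (Cox₂ k n))} (hp : p ∈ atlas k n) :
    ∃ i j, xv k i * yv k j ∉ p.asIdeal := by
  simp only [atlas, Opens.mem_iSup] at hp
  obtain ⟨i, hi⟩ := hp
  obtain ⟨j, hj⟩ := Opens.mem_iSup.mp hi
  exact ⟨i, j, hj⟩

theorem xv_pow_notMem {p : Spec (CommRingCat.of (Cox₂ k n))} {i j : Fin (n + 1)}
    (h : xv k i * yv k j ∉ p.asIdeal) (N : ℕ) : xv k i ^ N ∉ p.asIdeal := fun h' =>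
  h (Ideal.mul_mem_right _ _ (p.isPrime.mem_of_pow_mem N h'))

/-- The augmentation `u ^ a ↦ t ^ a`, with values in functions on `𝔸ⁿ⁺¹ × 𝔾ₘ`. -/
def augHom (k : Type u) [Field k] {n : ℕ} (d : Fin (n + 1) → ℕ) :
    (F' k d).X 0 ⟶ sectionsModule (CommRingCat.ofHom (shearRingHom k d)) :=
  ModuleCat.ofHom (Y := sectionsModule (CommRingCat.ofHom (shearRingHom k d)))
    { toFun := fun g : termF' k d 0 =>
        (Scheme.ΓSpecIso (CommRingCat.of (DiagRing k n))).inv.hom (augValue d g.1)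
      map_add' := fun g h => by
        refine (congrArg _ (augValue_add d g.1 h.1)).trans ?_
        exact map_add _ _ _
      map_smul' := fun r g => by
        refine (congrArg _ (augValue_smul d r g.1)).trans ?_
        refine (map_mul (Scheme.ΓSpecIso (CommRingCat.of (DiagRing k n))).inv.hom _ _).trans ?_
        exact (sectionsModule_smul (CommRingCat.ofHom (shearRingHom k d)) r _).symm }

theorem augHom_apply (d : Fin (n + 1) → ℕ) (g : termF' k d 0) :
    (augHom k d).hom g =
      (Scheme.ΓSpecIso (CommRingCat.of (DiagRing k n))).inv.hom (augValue d g.1) := rfl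

theorem F'_d_apply (d : Fin (n + 1) → ℕ) (i : ℕ) (g : termF' k d (i + 1)) :
    (((F' k d).d (i + 1) i).hom g : termF' k d i).1 = diff k d g.1 := by
  rw [F'_d]; rfl

/-- The augmentation `F'~ ⟶ 𝒪_Δ`. -/
def sheafAug (k : Type u) [Field k] {n : ℕ} (d : Fin (n + 1) → ℕ) :
    (sheafF' k d).X 0 ⟶ diagSheaf k d :=
  (sheafify k n).map (augHom k d) ≫
    (restrictedTildeSectionsIso (CommRingCat.ofHom (shearRingHom k d)) (atlas k n)).hom

theorem sheafAug_app_sectionOf (d : Fin (n + 1) → ℕ) (g : (F' k d).X 0) :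
    (sheafAug k d).app ⊤ (sectionOf ((F' k d).X 0) g) = diagSection d (augValue d g.1) := by
  refine (congrArg
    ((restrictedTildeSectionsIso (CommRingCat.ofHom (shearRingHom k d)) (atlas k n)).hom.app ⊤)
    (restrictedTilde_map_app_toOpen (atlas k n) (augHom k d) g)).trans ?_
  exact restrictedTildeSectionsIso_hom_app_toOpen _ _ _

theorem d_comp_augHom (d : Fin (n + 1) → ℕ) : (F' k d).d 1 0 ≫ augHom k d = 0 := by
  refine ModuleCat.hom_ext (LinearMap.ext fun g => ?_)
  refine (augHom_apply d (((F' k d).d 1 0).hom g)).trans ?_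
  refine (congrArg (fun s => (Scheme.ΓSpecIso (CommRingCat.of (DiagRing k n))).inv.hom
    (augValue d s)) (F'_d_apply d 0 g)).trans ?_
  refine (congrArg (Scheme.ΓSpecIso (CommRingCat.of (DiagRing k n))).inv.hom
    (augValue_diff d g.1)).trans ?_
  exact map_zero (Scheme.ΓSpecIso (CommRingCat.of (DiagRing k n))).inv.hom

theorem d_comp_sheafAug (d : Fin (n + 1) → ℕ) : (sheafF' k d).d 1 0 ≫ sheafAug k d = 0 := by
  have h : (sheafify k n).map ((F' k d).d 1 0) ≫ (sheafify k n).map (augHom k d) = 0 := by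
    rw [← Functor.map_comp, d_comp_augHom, Functor.map_zero]
  exact (Category.assoc _ _ _).symm.trans ((congrArg (· ≫ _) h).trans zero_comp)

theorem sheafF'_exactAt (d : Fin (n + 1) → ℕ) (hd : ∀ i, 0 < d i) (i : ℕ) :
    (sheafF' k d).ExactAt (i + 1) := by
  rw [HomologicalComplex.exactAt_iff' _ (i + 2) (i + 1) i (by simp) (by simp)]
  refine restrictedTilde_map_exact (atlas k n) ((F' k d).sc' (i + 2) (i + 1) i) ?_
  intro p hp (g : termF' k d (i + 1)) hg
  obtain ⟨l, j, hlj⟩ := mem_atlas hp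
  obtain ⟨N, h, hh, e⟩ := exists_diff_eq_of_diff_eq_zero d hd g.2
    ((F'_d_apply d i g).symm.trans (congrArg Subtype.val hg)) l
  refine ⟨_, xv_pow_notMem hlj N, (⟨h, hh⟩ : termF' k d (i + 2)), Subtype.ext ?_⟩
  exact (F'_d_apply d (i + 1) ⟨h, hh⟩).trans e

theorem sheafAug_exact (d : Fin (n + 1) → ℕ) (hd : ∀ i, 0 < d i) :
    (ShortComplex.mk ((sheafF' k d).d 1 0) (sheafAug k d) (d_comp_sheafAug d)).Exact := by
  have h := restrictedTilde_map_exact (atlas k n)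
    (ShortComplex.mk ((F' k d).d 1 0) (augHom k d) (d_comp_augHom d)) (by
      intro p hp (g : termF' k d 0) hg
      obtain ⟨l, j, hlj⟩ := mem_atlas hp
      have hg' : augValue d g.1 = 0 := by
        apply (ConcreteCategory.bijective_of_isIso
          (Scheme.ΓSpecIso (CommRingCat.of (DiagRing k n))).inv).1
        exact hg.trans (map_zero (Scheme.ΓSpecIso (CommRingCat.of (DiagRing k n))).inv.hom).symm
      obtain ⟨N, h, hh, e⟩ := exists_diff_eq_of_augValue_eq_zero d hd g.2 hg' l
      refine ⟨_, xv_pow_notMem hlj N, (⟨h, hh⟩ : termF' k d 1), Subtype.ext ?_⟩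
      exact (F'_d_apply d 0 ⟨h, hh⟩).trans e)
  -- Exactness was shown with target the sheaf of the module of functions; it is transported to
  -- `𝒪_Δ`.
  refine (ShortComplex.exact_iff_of_iso ?_).mp h
  exact ShortComplex.isoMk (Iso.refl _) (Iso.refl _)
    (restrictedTildeSectionsIso (CommRingCat.ofHom (shearRingHom k d)) (atlas k n))
    ((Category.id_comp _).trans (Category.comp_id _).symm) (Category.id_comp _)

/-- Surjectivity is exactness before a zero map, so the local criterion applies, now with powers of
`x_i y_j` as denominators. -/
theorem sheafAug_epi (d : Fin (n + 1) → ℕ) (hd : ∀ i, 0 < d i) : Epi (sheafAug k d) := by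
  have h := restrictedTilde_map_exact (atlas k n)
    (ShortComplex.mk (augHom k d) (0 : _ ⟶ (F' k d).X 0) comp_zero) (by
      intro p hp (s : Γ(Spec (CommRingCat.of (DiagRing k n)), ⊤)) _
      obtain ⟨i, j, hij⟩ := mem_atlas hp
      obtain ⟨N, g, hg, e⟩ := exists_augValue_eq d hd
        ((Scheme.ΓSpecIso (CommRingCat.of (DiagRing k n))).hom.hom s) i j
      refine ⟨_, fun h => hij (p.isPrime.mem_of_pow_mem N h), (⟨g, hg⟩ : termF' k d 0), ?_⟩
      refine (augHom_apply d ⟨g, hg⟩).trans ?_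
      refine (congrArg (Scheme.ΓSpecIso (CommRingCat.of (DiagRing k n))).inv.hom e).trans ?_
      refine (map_mul (Scheme.ΓSpecIso (CommRingCat.of (DiagRing k n))).inv.hom _ _).trans ?_
      refine Eq.trans ?_ (sectionsModule_smul (CommRingCat.ofHom (shearRingHom k d)) _ s).symm
      refine congrArg (_ * ·) ?_
      exact congr(($((Scheme.ΓSpecIso (CommRingCat.of (DiagRing k n))).hom_inv_id)).hom s))
  have : Epi ((sheafify k n).map (augHom k d)) :=
    (ShortComplex.exact_iff_epi _
      ((sheafify k n).map_zero _ _)).mp h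
  have h' (e : (sheafify k n).obj (sectionsModule (CommRingCat.ofHom (shearRingHom k d))) ≅
      diagSheaf k d) : Epi ((sheafify k n).map (augHom k d) ≫ e.hom) := epi_comp _ _
  exact h' _

theorem quasiIso_sheafAug (d : Fin (n + 1) → ℕ) (hd : ∀ i, 0 < d i) :
    QuasiIso ((ChainComplex.toSingle₀Equiv (sheafF' k d) (diagSheaf k d)).symm
      ⟨sheafAug k d, d_comp_sheafAug d⟩) where
  quasiIsoAt i := by
    cases i with
    | zero =>
      -- In degree `0` the condition is exactness at `F'_0` together with surjectivity of the
      -- augmentation.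
      rw [ChainComplex.quasiIsoAt₀_iff, ShortComplex.quasiIso_iff_of_zeros']
      · exact ⟨by simpa using! sheafAug_exact d hd, by simpa using! sheafAug_epi d hd⟩
      · exact (sheafF' k d).shape _ _ (by simp)
      · rfl
      · rfl
    | succ i =>
      rw [quasiIsoAt_iff_exactAt' _ _ (by exact ChainComplex.exactAt_succ_single_obj _ _)]
      exact sheafF'_exactAt d hd i

end Resolution

end Sheaves

end WPS

end

theorem theorem4p4 {k : Type*} [Field k] (n : ℕ) (d : Fin (n + 1) → ℕ) (hd : ∀ i, 0 < d i) :
    -- `F'` is a subcomplex of `F`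
    (∀ i (g : (WPS.F' k d).X i), (((WPS.inclF k d).f i).hom g).1 = g.1) ∧
    -- `F'_i` is free of finite rank, with basis the `u ^ a e_I` such that `b < w - a`
    (∀ i, Finite (WPS.Gen d i) ∧
      ∃ B : Module.Basis (WPS.Gen d i) (WPS.Cox₂ k n) ((WPS.F' k d).X i),
        ∀ p : WPS.Gen d i, (B p).1 = Pi.single p.1.2 (Polynomial.X ^ p.1.1)) ∧
    -- `F'` has length `n`
    (∀ i, n < i → Subsingleton ((WPS.F' k d).X i)) ∧
    -- the differential of `F'` is homogeneous
    (∀ i j χ (g : (WPS.F' k d).X i), WPS.IsHomog d χ g.1 →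
      WPS.IsHomog d χ (((WPS.F' k d).d i j).hom g).1) ∧
    -- the sheafification of `F'` is a resolution of `𝒪_Δ` by an equivariant augmentation
    (∃ (π : (WPS.sheafF' k d).X 0 ⟶ WPS.diagSheaf k d)
        (hπ : (WPS.sheafF' k d).d 1 0 ≫ π = 0),
      (∀ g : (WPS.F' k d).X 0,
        π.app ⊤ (WPS.sectionOf ((WPS.F' k d).X 0) g) =
          WPS.diagSection d (WPS.augValue d g.1)) ∧
      (∀ χ (g : (WPS.F' k d).X 0), WPS.IsHomog d χ g.1 →
        WPS.HasWeight d χ (WPS.augValue d g.1)) ∧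
      QuasiIso ((ChainComplex.toSingle₀Equiv (WPS.sheafF' k d) (WPS.diagSheaf k d)).symm
        ⟨π, hπ⟩)) := by
  refine ⟨fun i g => rfl, fun i => ⟨inferInstance, WPS.termF'Basis k d i,
    WPS.termF'Basis_apply d i⟩, fun i hi => WPS.subsingleton_termF' d hi, ?_,
    WPS.sheafAug k d, WPS.d_comp_sheafAug d, WPS.sheafAug_app_sectionOf d,
    fun χ g hg => WPS.hasWeight_augValue d χ hg, WPS.quasiIso_sheafAug d hd⟩
  intro i j χ g hg
  by_cases hij : j + 1 = i
  · subst hij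
    exact (congrArg (WPS.IsHomog d χ) (WPS.F'_d_apply d j g)).mpr (WPS.isHomog_diff d χ hg)
  · have h0 : (((WPS.F' k d).d i j).hom g).1 = 0 := by
      rw [(WPS.F' k d).shape i j hij]; rfl
    exact (congrArg (WPS.IsHomog d χ) h0).mpr (WPS.isHomog_zero d χ)
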